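/- Let $M$ be a smooth manifold and $Z$ a smooth bivector field on $M$. Let $Z^\sharp\colon T^*M\to TM$, $\xi\mapsto Z(\xi,\cdot)$, and for a $2$-form $\beta$ let $\beta^\sharp\colon TM\to T^*M$, $v\mapsto \beta(v,\cdot)$. For a $k$-form $\alpha$ write $|\alpha|=k$. Let $\iota_Z$ be the contraction with $Z$, where $\iota_{X\wedge Y}=\iota_X\iota_Y$, let $\mathcal L_Z=\iota_Z\circ d-d\circ\iota_Z$, and let $$[\alpha,\beta]_Z=(-1)^{|\alpha|+1}\big(\mathcal L_Z(\alpha\wedge\beta)-\mathcal L_Z(\alpha)\wedge\beta-(-1)^{|\alpha|}\alpha\wedge\mathcal L_Z(\beta)\big)$$ be the Koszul bracket on $\Omega(M)$. Let $[Z,Z]$ be the Schouten bracket, normalized by $[X\wedge Y,X\wedge Y]=2\,[X,Y]\wedge X\wedge Y$ for vector fields $X,Y$, and let $$[\alpha,\beta,\gamma]_Z=(\alpha^\sharp\wedge\beta^\sharp\wedge\gamma^\sharp)\big(\tfrac12[Z,Z]\big),\qquad (\alpha^\sharp\wedge\beta^\sharp\wedge\gamma^\sharp)(v_1\wedge v_2\wedge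 v_3)=\sum_{\sigma\in S_3}\operatorname{sgn}(\sigma)\,\iota_{v_{\sigma(1)}}\alpha\wedge\iota_{v_{\sigma(2)}}\beta\wedge\iota_{v_{\sigma(3)}}\gamma .$$ Consider on $\Omega(M)[2]$ the brackets (of the $L_\infty[1]$-algebra associated with $Z$) $\lambda_1=d$, $\lambda_2(\alpha,\beta)=(-1)^{|\alpha|}[\alpha,\beta]_Z$ and $\lambda_3(\alpha,\beta,\gamma)=(-1)^{|\beta|+1}[\alpha,\beta,\gamma]_Z$. A $2$-form $\beta$ is called a Maurer–Cartan element if $$d\beta+\tfrac12\lambda_2(\beta,\beta)+\tfrac16\lambda_3(\beta,\beta,\beta)=0 .$$ Let $\mathcal I_Z\subset\wedge^2T^*M$ be the set of all $\beta\in\wedge^2T_x^*M$, $x\in M$, for which $\mathrm{id}_{T_xM}+Z_x^\sharp\beta^\sharp$ is invertible. Then $\mathcal I_Z$ is an open subset of $\wedge^2T^*M$ which contains the zero section. Moreover, for every smooth $2$-form $\beta$ on $M$ with values in $\mathcal I_Z$, the formula $F(\beta)^\sharp=\beta^\sharp(\mathrm{id}+Z^\sharp\beta^\sharp)^{-1}$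 defines a smooth $2$-form $F(\beta)$ on $M$, and $\beta$ is a Maurer–Cartan element if and only if $F(\beta)$ is closed. -/

import Mathlib

open scoped Manifold ContDiff

noncomputable section

namespace KoszulMC

/-! ## Linear algebra at a point

For a manifold `M` modelled on `E n = ℝⁿ`, Mathlib's tangent space `TangentSpace (𝓡 n) x` is by
definition `E n`, for every point `x`.  So `V = E n` below plays the role of `T_x M`. -/

/-- The model space `ℝⁿ`, which is also the tangent space at every point. -/
abbrev E (n : ℕ) : Type := EuclideanSpace ℝ (Fin n)

/-- The cotangent space `V*`. -/
abbrev Cov (n : ℕ) : Type := E n →L[ℝ] ℝ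

/-- `∧ᵏ V*`: alternating `k`-linear forms on `V`. -/
abbrev Alt (n k : ℕ) : Type := E n [⋀^Fin k]→L[ℝ] ℝ

/-- `∧ᵏ V`: alternating `k`-linear forms on `V*`
(`v₁ ∧ ⋯ ∧ vₖ` is the form `(ξ₁, …, ξₖ) ↦ det (ξᵢ (vⱼ))`). -/
abbrev MV (n k : ℕ) : Type := Cov n [⋀^Fin k]→L[ℝ] ℝ

/-- The exterior algebra `∧ V* = ⨁ₖ ∧ᵏ V*`; an element is the family of its homogeneous
components (those of degree `k > n` are automatically zero). -/
abbrev Ext (n : ℕ) : Type := ∀ k : ℕ, Alt n k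

/-- The standard basis of `V`. -/
def e {n : ℕ} (i : Fin n) : E n := EuclideanSpace.single i 1

/-- The dual basis of `V*`. -/
def dx {n : ℕ} (i : Fin n) : Cov n := EuclideanSpace.proj i

/-- `β♯ : V → V*`, `v ↦ β(v, ·)`. -/
def formSharp {n : ℕ} (β : Alt n 2) : E n →L[ℝ] Cov n :=
  LinearMap.toContinuousLinearMap
    { toFun := fun v => (ContinuousAlternatingMap.ofSubsingleton ℝ (E n) ℝ (0 : Fin 1)).symm
        (β.curryLeft v)
      map_add' := fun v w => by ext; simp
      map_smul' := fun c v => by ext; simp }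

theorem formSharp_apply {n : ℕ} (β : Alt n 2) (v w : E n) : formSharp β v w = β ![v, w] := by
  change β _ = _
  congr 1
  ext i
  fin_cases i <;> rfl

/-- `Z♯ : V* → V`, the vector `Z(ξ, ·) ∈ V** = V`, that is, `∑ᵢ Z(ξ, dxⁱ) eᵢ`. -/
def bivSharp {n : ℕ} (Z : MV n 2) : Cov n →L[ℝ] E n :=
  LinearMap.toContinuousLinearMap
    { toFun := fun ξ => ∑ i, Z ![ξ, dx i] • e i
      map_add' := fun ξ η => by
        simp only [← Finset.sum_add_distrib, ← add_smul]
        exact Finset.sum_congr rfl fun i _ => congrArg (· • e i) (Z.map_vecCons_add _ ξ η)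
      map_smul' := fun c ξ => by
        simp only [Finset.smul_sum, smul_smul, RingHom.id_apply]
        exact Finset.sum_congr rfl fun i _ => congrArg (· • e i) (Z.map_vecCons_smul _ c ξ) }

theorem apply_bivSharp {n : ℕ} (Z : MV n 2) (ξ η : Cov n) : η (bivSharp Z ξ) = Z ![ξ, η] := by
  have h : η = ∑ i, η (e i) • dx i := by
    ext v
    conv_lhs => rw [← (EuclideanSpace.basisFun (Fin n) ℝ).sum_repr v]
    simp [dx, e, mul_comm]
  have hu : ∀ θ : Cov n, Function.update ![ξ, 0] 1 θ = ![ξ, θ] := fun θ => by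
    ext i : 1
    fin_cases i <;> rfl
  let L : Cov n →ₗ[ℝ] ℝ :=
    { toFun := fun θ => Z ![ξ, θ]
      map_add' := fun θ θ' => by
        rw [← hu (θ + θ'), ← hu θ, ← hu θ']
        exact Z.map_update_add ![ξ, 0] 1 θ θ'
      map_smul' := fun c θ => by
        rw [← hu (c • θ), ← hu θ]
        exact Z.map_update_smul ![ξ, 0] 1 c θ }
  have h2 : Z ![ξ, η] = ∑ i, η (e i) * Z ![ξ, dx i] := by
    change L η = ∑ i, η (e i) * L (dx i)
    conv_lhs => rw [h]
    simp
  rw [h2]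
  change η (∑ i, Z ![ξ, dx i] • e i) = _
  simp [mul_comm]

/-- `𝓘_Z`: the `β ∈ ∧² V*` for which `id + Z♯ β♯ : V → V` is invertible. -/
def invSet {n : ℕ} (Z : MV n 2) : Set (Alt n 2) :=
  {β | IsUnit (1 + bivSharp Z ∘L formSharp β : E n →L[ℝ] E n)}

/-- A bilinear map `B : V → V*` with `B v v = 0`, as an alternating form. -/
def ofSharp {n : ℕ} (B : E n →L[ℝ] Cov n) (hB : ∀ v, B v v = 0) : Alt n 2 where
  toFun v := B (v 0) (v 1)
  map_update_add' v i x y := by fin_cases i <;> simp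
  map_update_smul' v i c x := by fin_cases i <;> simp
  map_eq_zero_of_eq' v i j hij hne := by
    fin_cases i <;> fin_cases j <;> simp_all
  cont := by
    change Continuous fun v : Fin 2 → E n => B (v 0) (v 1)
    fun_prop

theorem formSharp_inverse_self {n : ℕ} (Z : MV n 2) (β : Alt n 2) (hβ : β ∈ invSet Z) (v : E n) :
    formSharp β (Ring.inverse (1 + bivSharp Z ∘L formSharp β : E n →L[ℝ] E n) v) v = 0 := by
  obtain ⟨w, rfl⟩ : ∃ w, (1 + bivSharp Z ∘L formSharp β : E n →L[ℝ] E n) w = v :=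
    ⟨Ring.inverse (1 + bivSharp Z ∘L formSharp β : E n →L[ℝ] E n) v, by
      rw [← mul_apply_eq_comp, Ring.mul_inverse_cancel _ hβ]; rfl⟩
  rw [← mul_apply_eq_comp, Ring.inverse_mul_cancel _ hβ]
  simp only [one_apply_eq_self, add_apply,
    ContinuousLinearMap.comp_apply, map_add, apply_bivSharp]
  rw [formSharp_apply, β.map_eq_zero_of_eq ![w, w] (i := 0) (j := 1) rfl (by decide),
    Z.map_eq_zero_of_eq ![formSharp β w, formSharp β w] (i := 0) (j := 1) rfl (by decide),
    add_zero]

/-- `F(β) ∈ ∧² V*` for `β ∈ 𝓘_Z`: the form with `F(β)♯ = β♯ (id + Z♯ β♯)⁻¹`. -/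
def F {n : ℕ} (Z : MV n 2) (β : Alt n 2) (hβ : β ∈ invSet Z) : Alt n 2 :=
  ofSharp (formSharp β ∘L Ring.inverse (1 + bivSharp Z ∘L formSharp β : E n →L[ℝ] E n))
    (formSharp_inverse_self Z β hβ)

theorem formSharp_F {n : ℕ} (Z : MV n 2) (β : Alt n 2) (hβ : β ∈ invSet Z) :
    formSharp (F Z β hβ) =
      formSharp β ∘L Ring.inverse (1 + bivSharp Z ∘L formSharp β : E n →L[ℝ] E n) := by
  ext v w
  rw [formSharp_apply]
  rfl

/-- The wedge product
`(α ∧ β)(v) = 1/(p! q!) ∑_σ sgn(σ) α(v_{σ(1)}, …, v_{σ(p)}) β(v_{σ(p+1)}, …, v_{σ(p+q)})`. -/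
def wedgeHom {n p q m : ℕ} (h : p + q = m) (α : Alt n p) (β : Alt n q) : Alt n m :=
  ((p.factorial : ℝ) * (q.factorial : ℝ))⁻¹ • ContinuousMultilinearMap.alternatization
    { toMultilinearMap := ((LinearMap.mul' ℝ ℝ).compMultilinearMap
        (MultilinearMap.domCoprod α.toMultilinearMap β.toMultilinearMap)).domDomCongr
          (finSumFinEquiv.trans (finCongr h))
      cont := by
        change Continuous fun v : Fin m → E n =>
          α (fun i => v (Fin.cast h (Fin.castAdd q i))) *
            β (fun j => v (Fin.cast h (Fin.natAdd p j)))
        fun_prop }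

theorem wedgeHom_apply {n p q m : ℕ} (h : p + q = m) (α : Alt n p) (β : Alt n q)
    (v : Fin m → E n) :
    wedgeHom h α β v = ((p.factorial : ℝ) * (q.factorial : ℝ))⁻¹ *
      ∑ σ : Equiv.Perm (Fin m), (Equiv.Perm.sign σ : ℝ) *
        (α (fun i => v (σ (Fin.cast h (Fin.castAdd q i)))) *
          β (fun j => v (σ (Fin.cast h (Fin.natAdd p j))))) := by
  simp only [wedgeHom, ContinuousAlternatingMap.smul_apply,
    ContinuousMultilinearMap.alternatization_apply_apply, smul_eq_mul]
  congr 1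
  refine Finset.sum_congr rfl fun σ _ => ?_
  rw [Units.smul_def, zsmul_eq_mul]
  rfl

/-- The wedge product on `∧ V*`. -/
def wedge {n : ℕ} (α β : Ext n) : Ext n := fun m =>
  ∑ i : Fin (m + 1), wedgeHom (p := (i : ℕ)) (q := m - i) (by omega) (α i) (β (m - i))

/-- Interior product `ι_v τ = τ(v, ·, …, ·)`. -/
def interiorProd {n : ℕ} (v : E n) (τ : Ext n) : Ext n := fun k => (τ (k + 1)).curryLeft v

/-- Contraction with a bivector: the linear extension in `Z` of `ι_{u ∧ v} = ι_u ι_v`, that is,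
`ι_Z = ½ ∑ᵢⱼ Z(dxⁱ, dxʲ) ι_{eᵢ} ι_{eⱼ}`. -/
def contract {n : ℕ} (Z : MV n 2) (τ : Ext n) : Ext n :=
  (1 / 2 : ℝ) • ∑ i, ∑ j, Z ![dx i, dx j] • interiorProd (e i) (interiorProd (e j) τ)

/-- The degree involution `α ↦ (-1)^{|α|} α`. -/
def gradeInv {n : ℕ} (α : Ext n) : Ext n := fun k => (-1 : ℝ) ^ k • α k

/-- `(α♯ ∧ β♯ ∧ γ♯)(v₁ ∧ v₂ ∧ v₃) =
∑_{σ ∈ S₃} sgn(σ) α♯(v_{σ(1)}) ∧ β♯(v_{σ(2)}) ∧ γ♯(v_{σ(3)})`, where `α♯(v) = ι_v α`. -/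
def sharpWedge {n : ℕ} (α β γ : Ext n) (v : Fin 3 → E n) : Ext n :=
  ∑ σ : Equiv.Perm (Fin 3), (Equiv.Perm.sign σ : ℝ) •
    wedge (wedge (interiorProd (v (σ 0)) α) (interiorProd (v (σ 1)) β)) (interiorProd (v (σ 2)) γ)

/-- The linear extension `(α♯ ∧ β♯ ∧ γ♯)(T)` to all trivectors
`T = 1/6 ∑ᵢⱼₖ T(dxⁱ, dxʲ, dxᵏ) eᵢ ∧ eⱼ ∧ eₖ`. -/
def sharpWedgeTri {n : ℕ} (α β γ : Ext n) (T : MV n 3) : Ext n :=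
  (1 / 6 : ℝ) • ∑ i, ∑ j, ∑ k, T ![dx i, dx j, dx k] • sharpWedge α β γ ![e i, e j, e k]

/-! ## Forms and multivector fields on a manifold -/

section Manifold

variable {n : ℕ} {M : Type*} [TopologicalSpace M] [ChartedSpace (E n) M]

/-- Derivative of the chart `φ` at `x₀`, `T_x M → ℝⁿ`. -/
def dChart (x₀ x : M) : E n →L[ℝ] E n :=
  mfderiv (𝓡 n) 𝓘(ℝ, E n) (extChartAt (𝓡 n) x₀) x

/-- Derivative of the inverse of the chart `φ` at `x₀`, `ℝⁿ → T_{φ⁻¹(y)} M`. -/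
def dChartSymm (x₀ : M) (y : E n) : E n →L[ℝ] E n :=
  mfderiv 𝓘(ℝ, E n) (𝓡 n) (extChartAt (𝓡 n) x₀).symm y

/-- A field of `k`-forms in the chart at `x₀`: the pullback along the inverse of the chart. -/
def formInChart {k : ℕ} (τ : M → Alt n k) (x₀ : M) (y : E n) : Alt n k :=
  (τ ((extChartAt (𝓡 n) x₀).symm y)).compContinuousLinearMap (dChartSymm x₀ y)

/-- A field of `k`-vectors in the chart at `x₀`: the push-forward along the chart. -/
def mvInChart {k : ℕ} (Z : M → MV n k) (x₀ : M) (y : E n) : MV n k :=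
  (Z ((extChartAt (𝓡 n) x₀).symm y)).compContinuousLinearMap
    (ContinuousLinearMap.precomp ℝ (dChart x₀ ((extChartAt (𝓡 n) x₀).symm y)))

/-- Smooth `k`-forms, the elements of `Ωᵏ(M)`: smooth in the charts. -/
def SmoothForm {k : ℕ} (τ : M → Alt n k) : Prop :=
  ∀ x₀ : M, ContDiffOn ℝ ∞ (formInChart τ x₀) (extChartAt (𝓡 n) x₀).target

/-- Smooth `k`-vector fields: smooth in the charts. -/
def SmoothMV {k : ℕ} (Z : M → MV n k) : Prop :=
  ∀ x₀ : M, ContDiffOn ℝ ∞ (mvInChart Z x₀) (extChartAt (𝓡 n) x₀).target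

/-- A family of subsets `U x ⊆ ∧² T*_x M` is open as a subset of the total space of the vector
bundle `∧² T*M`: it is open in the trivializations `φ(dom φ) × ∧² (ℝⁿ)*` given by the charts. -/
def IsOpenInTwoForms (U : M → Set (Alt n 2)) : Prop :=
  ∀ x₀ : M, IsOpen {p : E n × Alt n 2 | p.1 ∈ (extChartAt (𝓡 n) x₀).target ∧
    p.2.compContinuousLinearMap (dChart x₀ ((extChartAt (𝓡 n) x₀).symm p.1)) ∈
      U ((extChartAt (𝓡 n) x₀).symm p.1)}

/-- The exterior derivative of a `k`-form, computed at `x` in the chart at `x`. -/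
def extD {k : ℕ} (τ : M → Alt n k) (x : M) : Alt n (k + 1) :=
  (extDeriv (formInChart τ x) (extChartAt (𝓡 n) x x)).compContinuousLinearMap (dChart x x)

/-- A form is closed if its exterior derivative is zero. -/
def IsClosedForm {k : ℕ} (τ : M → Alt n k) : Prop := ∀ x, extD τ x = 0

/-- The Schouten bracket of bivector fields on `ℝⁿ`:
`[P, Q](ξ₁, ξ₂, ξ₃) = ∑_cyc ((D_{P♯ξ₁} Q)(ξ₂, ξ₃) + (D_{Q♯ξ₁} P)(ξ₂, ξ₃))` for constant
covectors `ξᵢ`, that is, in coordinates,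
`[P, Q]ⁱʲᵏ = ∑_cyc ∑ₗ (Pⁱˡ ∂ₗ Qʲᵏ + Qⁱˡ ∂ₗ Pʲᵏ)`, where the cyclic sum is over `i, j, k`.
It satisfies
`[X ∧ Y, X' ∧ Y'] = [X,X'] ∧ Y ∧ Y' - [X,Y'] ∧ Y ∧ X' - [Y,X'] ∧ X ∧ Y' + [Y,Y'] ∧ X ∧ X'`. -/
def schoutenModel (P Q : E n → MV n 2) (y : E n) : MV n 3 :=
  ContinuousAlternatingMap.alternatizeUncurryFin
    (fderiv ℝ Q y ∘L bivSharp (P y) + fderiv ℝ P y ∘L bivSharp (Q y))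

/-- The Schouten bracket of bivector fields on `M`, computed at `x` in the chart at `x`. -/
def schouten (P Q : M → MV n 2) (x : M) : MV n 3 :=
  (schoutenModel (mvInChart P x) (mvInChart Q x)
    (extChartAt (𝓡 n) x x)).compContinuousLinearMap
      (ContinuousLinearMap.precomp ℝ (dChartSymm x (extChartAt (𝓡 n) x x)))

/-- The inclusion of `Ωᵏ(M)` into `Ω(M)`. -/
def ofDegree (k : ℕ) (τ : M → Alt n k) : M → Ext n := fun x => Pi.single k (τ x)

/-- The de Rham differential on `Ω(M)`. -/
def deRham (τ : M → Ext n) : M → Ext n := fun x k =>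
  match k with
  | 0 => 0
  | j + 1 => extD (fun y => τ y j) x

/-- Contraction with a bivector field. -/
def iota (Z : M → MV n 2) (τ : M → Ext n) : M → Ext n := fun x => contract (Z x) (τ x)

/-- `𝓛_Z = ι_Z ∘ d - d ∘ ι_Z`. -/
def lieZ (Z : M → MV n 2) (τ : M → Ext n) : M → Ext n :=
  iota Z (deRham τ) - deRham (iota Z τ)

/-- Pointwise wedge product on `Ω(M)`. -/
def wedgeF (α β : M → Ext n) : M → Ext n := fun x => wedge (α x) (β x)

/-- Pointwise degree involution on `Ω(M)`. -/
def gradeInvF (α : M → Ext n) : M → Ext n := fun x => gradeInv (α x)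

/-- The Koszul bracket: the bilinear operation on `Ω(M)` given for homogeneous `α` by
`[α,β]_Z = (-1)^{|α|+1} (𝓛_Z(α ∧ β) - 𝓛_Z(α) ∧ β - (-1)^{|α|} α ∧ 𝓛_Z(β))`. -/
def koszulBracket (Z : M → MV n 2) (α β : M → Ext n) : M → Ext n :=
  -(lieZ Z (wedgeF (gradeInvF α) β) - wedgeF (lieZ Z (gradeInvF α)) β - wedgeF α (lieZ Z β))

/-- The trinary bracket `[α,β,γ]_Z = (α♯ ∧ β♯ ∧ γ♯)(½[Z,Z])`. -/
def trinaryBracket (Z : M → MV n 2) (α β γ : M → Ext n) : M → Ext n :=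
  fun x => sharpWedgeTri (α x) (β x) (γ x) ((1 / 2 : ℝ) • schouten Z Z x)

/-- `λ₁ = d`. -/
def lambda1 (α : M → Ext n) : M → Ext n := deRham α

/-- `λ₂(α, β) = (-1)^{|α|} [α,β]_Z`. -/
def lambda2 (Z : M → MV n 2) (α β : M → Ext n) : M → Ext n := koszulBracket Z (gradeInvF α) β

/-- `λ₃(α, β, γ) = (-1)^{|β|+1} [α,β,γ]_Z`. -/
def lambda3 (Z : M → MV n 2) (α β γ : M → Ext n) : M → Ext n :=
  -trinaryBracket Z α (gradeInvF β) γ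

/-- The Maurer–Cartan equation `λ₁(β) + ½ λ₂(β, β) + ⅙ λ₃(β, β, β) = 0` in `Ω(M)` for a `2`-form
`β`. -/
def IsMaurerCartan (Z : M → MV n 2) (β : M → Alt n 2) : Prop :=
  lambda1 (ofDegree 2 β) + (1 / 2 : ℝ) • lambda2 Z (ofDegree 2 β) (ofDegree 2 β) +
    (1 / 6 : ℝ) • lambda3 Z (ofDegree 2 β) (ofDegree 2 β) (ofDegree 2 β) = 0

/-- The `2`-form `F(β)` on `M`, for a `2`-form `β` with values in `𝓘_Z`. -/
def FForm (Z : M → MV n 2) (β : M → Alt n 2) (hβ : ∀ x, β x ∈ invSet (Z x)) : M → Alt n 2 :=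
  fun x => F (Z x) (β x) (hβ x)

end Manifold

end KoszulMC

end

/-!
Fix `x` and put `A = id + Z♯ β♯`. The equation `F(β)♯ ∘ A = β♯` says that `F(β)(A v, w) = β(v, w)`.
Differentiating it in a chart along a constant vector `a`, and eliminating the derivative of `A`,
gives
`(D_a F(β))(A v, A w) = (D_a β)(v, w) + (D_a Z)(β♯ v, β♯ w)` (`fderiv_apply_add_sharp`).
Antisymmetrizing with `a = A u` expresses `dF(β)(A u, A v, A w)` as a cyclic sum of four kinds of
terms, since `A u = u + Z♯ β♯ u` (`extDeriv_apply_add_sharp`). They are the terms of the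
Maurer–Cartan expression evaluated at `(u, v, w)`:

* `(D_u β)(v, w)` gives `dβ`;
* `(D_{Z♯ β♯ u} Z)(β♯ v, β♯ w)` gives `½ [Z, Z](β♯ u, β♯ v, β♯ w)`, which is `⅙ λ₃(β, β, β)`;
* `(D_{Z♯ β♯ u} β)(v, w) + (D_u Z)(β♯ v, β♯ w)` gives `½ λ₂(β, β)`.

The last point is the computation of the Koszul bracket (`maurerCartan_model`). It uses
`ι_Z (β ∧ β) = 2 (ι_Z β) β + 2 Z(β♯ ·, β♯ ·)`, whose right-hand side is built from the trace of
`Z♯ β♯` and from a pullback of `Z`, so that it visibly commutes with changes of coordinates; what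
remains is a polynomial identity between the coefficients of `Z`, `β` and the derivatives of `β`
(`coeffSum_identity`). So the Maurer–Cartan expression is the pullback of `dF(β)` under `A`
(`maurerCartanForm_apply`), and as `A` is invertible, one vanishes exactly when the other does.

Openness of `𝓘_Z` and smoothness of `F(β)` hold because the units of the algebra of endomorphisms
are open and inversion is smooth on them, and because `A` in a chart is the corresponding
endomorphism for the coordinate expressions of `Z` and `β` (`one_add_sharp_pullback`).
-/

namespace KoszulMC

variable {n : ℕ}

/-! ### Sums over small symmetric groups -/

theorem decomposeFin_symm_apply_two {m : ℕ} (p : Fin (m + 3)) (σ : Equiv.Perm (Fin (m + 2))) :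
    Equiv.Perm.decomposeFin.symm (p, σ) 2 = Equiv.swap 0 p (σ 1).succ :=
  Equiv.Perm.decomposeFin_symm_apply_succ σ p 1

theorem decomposeFin_symm_apply_three {m : ℕ} (p : Fin (m + 4)) (σ : Equiv.Perm (Fin (m + 3))) :
    Equiv.Perm.decomposeFin.symm (p, σ) 3 = Equiv.swap 0 p (σ 2).succ :=
  Equiv.Perm.decomposeFin_symm_apply_succ σ p 2

theorem sum_perm_fin_three {G : Type*} [AddCommGroup G] [Module ℝ G]
    (g : Fin 3 → Fin 3 → Fin 3 → G) :
    ∑ σ : Equiv.Perm (Fin 3), (Equiv.Perm.sign σ : ℝ) • g (σ 0) (σ 1) (σ 2) =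
      g 0 1 2 - g 0 2 1 - g 1 0 2 + g 1 2 0 + g 2 0 1 - g 2 1 0 := by
  simp only [Finset.univ_perm_fin_succ, Finset.sum_map, Finset.sum_product, Fin.sum_univ_succ,
    ← Finset.univ_product_univ, Finset.univ_unique, Finset.sum_singleton, Equiv.toEmbedding_apply]
  simp [Equiv.Perm.decomposeFin.symm_sign, Equiv.swap_apply_def, decomposeFin_symm_apply_two]
  abel

theorem sum_perm_fin_four (g : Fin 4 → Fin 4 → Fin 4 → Fin 4 → ℝ) :
    ∑ σ : Equiv.Perm (Fin 4), (Equiv.Perm.sign σ : ℝ) * g (σ 0) (σ 1) (σ 2) (σ 3) =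
      (g 0 1 2 3 - g 0 1 3 2 - g 0 2 1 3 + g 0 2 3 1 + g 0 3 1 2 - g 0 3 2 1) -
      (g 1 0 2 3 - g 1 0 3 2 - g 1 2 0 3 + g 1 2 3 0 + g 1 3 0 2 - g 1 3 2 0) +
      (g 2 0 1 3 - g 2 0 3 1 - g 2 1 0 3 + g 2 1 3 0 + g 2 3 0 1 - g 2 3 1 0) -
      (g 3 0 1 2 - g 3 0 2 1 - g 3 1 0 2 + g 3 1 2 0 + g 3 2 0 1 - g 3 2 1 0) := by
  simp only [Finset.univ_perm_fin_succ, Finset.sum_map, Finset.sum_product, Fin.sum_univ_succ,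
    ← Finset.univ_product_univ, Finset.univ_unique, Finset.sum_singleton, Equiv.toEmbedding_apply]
  simp [Equiv.Perm.decomposeFin.symm_sign, Equiv.swap_apply_def, decomposeFin_symm_apply_two,
    decomposeFin_symm_apply_three]
  abel

/-! ### Two-forms and bivectors as antisymmetric bilinear forms -/

section Bilinear

variable {V : Type*} [NormedAddCommGroup V] [NormedSpace ℝ V]

theorem alt_swap (β : V [⋀^Fin 2]→L[ℝ] ℝ) (v w : V) : β ![v, w] = -β ![w, v] := by
  have h := β.toAlternatingMap.map_swap ![w, v] (i := 0) (j := 1) (by decide)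
  rw [← ContinuousAlternatingMap.coe_toAlternatingMap, ← h]
  congr 1
  ext i
  fin_cases i <;> rfl

theorem alt_ext_two {β γ : V [⋀^Fin 2]→L[ℝ] ℝ} (h : ∀ v w, β ![v, w] = γ ![v, w]) : β = γ := by
  ext v
  have : v = ![v 0, v 1] := by ext i; fin_cases i <;> rfl
  rw [this, h]

theorem alt_ext_three {β γ : V [⋀^Fin 3]→L[ℝ] ℝ}
    (h : ∀ u v w, β ![u, v, w] = γ ![u, v, w]) : β = γ := by
  ext v
  have : v = ![v 0, v 1, v 2] := by ext i; fin_cases i <;> rfl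
  rw [this, h]

end Bilinear

/-! ### Wedge products of homogeneous elements -/

theorem wedgeHom_zero_left {p q m : ℕ} (h : p + q = m) (β : Alt n q) :
    wedgeHom h (0 : Alt n p) β = 0 := by
  ext v
  simp [wedgeHom_apply]

theorem wedgeHom_zero_right {p q m : ℕ} (h : p + q = m) (α : Alt n p) :
    wedgeHom h α (0 : Alt n q) = 0 := by
  ext v
  simp [wedgeHom_apply]

theorem wedge_single {p q : ℕ} (α : Alt n p) (β : Alt n q) :
    wedge (Pi.single p α) (Pi.single q β) = Pi.single (p + q) (wedgeHom rfl α β) := by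
  have key : ∀ (q' m : ℕ) (h : p + q' = m),
      wedgeHom h α ((Pi.single q β : Ext n) q') = (Pi.single (p + q) (wedgeHom rfl α β) : Ext n) m := by
    rintro q' _ rfl
    by_cases hq : q' = q
    · subst hq
      simp
    · rw [Pi.single_eq_of_ne hq, wedgeHom_zero_right, Pi.single_eq_of_ne (by omega)]
  funext m
  by_cases hpm : p ≤ m
  · rw [wedge, Finset.sum_eq_single (⟨p, by omega⟩ : Fin (m + 1))]
    · simpa using key (m - p) m (by omega)
    · intro i _ hi
      rw [Pi.single_eq_of_ne (fun h => hi (Fin.ext h)), wedgeHom_zero_left]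
    · simp
  · rw [Pi.single_eq_of_ne (by omega)]
    refine Finset.sum_eq_zero fun i _ => ?_
    rw [Pi.single_eq_of_ne (by omega), wedgeHom_zero_left]

theorem wedgeHom_two_two (β γ : Alt n 2) (a b c d : E n) :
    wedgeHom rfl β γ ![a, b, c, d] =
      β ![a, b] * γ ![c, d] - β ![a, c] * γ ![b, d] + β ![a, d] * γ ![b, c] +
      (γ ![a, b] * β ![c, d] - γ ![a, c] * β ![b, d] + γ ![a, d] * β ![b, c]) := by
  rw [wedgeHom_apply]
  have h1 : ∀ σ : Equiv.Perm (Fin 4),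
      (fun i : Fin 2 => ![a, b, c, d] (σ (Fin.cast rfl (Fin.castAdd 2 i)))) =
        ![![a, b, c, d] (σ 0), ![a, b, c, d] (σ 1)] := fun σ => by
    ext i : 1; fin_cases i <;> rfl
  have h2 : ∀ σ : Equiv.Perm (Fin 4),
      (fun i : Fin 2 => ![a, b, c, d] (σ (Fin.cast rfl (Fin.natAdd 2 i)))) =
        ![![a, b, c, d] (σ 2), ![a, b, c, d] (σ 3)] := fun σ => by
    ext i : 1; fin_cases i <;> rfl
  simp_rw [h1, h2]
  rw [sum_perm_fin_four fun i j k l => β ![![a, b, c, d] i, ![a, b, c, d] j] *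
    γ ![![a, b, c, d] k, ![a, b, c, d] l]]
  simp only [Matrix.cons_val]
  rw [alt_swap β b a, alt_swap β c a, alt_swap β d a, alt_swap β c b, alt_swap β d b,
    alt_swap β d c, alt_swap γ b a, alt_swap γ c a, alt_swap γ d a, alt_swap γ c b,
    alt_swap γ d b, alt_swap γ d c]
  norm_num [Nat.factorial]
  ring

theorem wedgeHom_one_two (θ : Alt n 1) (β : Alt n 2) (a b c : E n) :
    wedgeHom rfl θ β ![a, b, c] =
      θ ![a] * β ![b, c] - θ ![b] * β ![a, c] + θ ![c] * β ![a, b] := by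
  rw [wedgeHom_apply]
  have h1 : ∀ σ : Equiv.Perm (Fin 3),
      (fun i : Fin 1 => ![a, b, c] (σ (Fin.cast rfl (Fin.castAdd 2 i)))) =
        ![![a, b, c] (σ 0)] := fun σ => by
    ext i : 1; fin_cases i; rfl
  have h2 : ∀ σ : Equiv.Perm (Fin 3),
      (fun i : Fin 2 => ![a, b, c] (σ (Fin.cast rfl (Fin.natAdd 1 i)))) =
        ![![a, b, c] (σ 1), ![a, b, c] (σ 2)] := fun σ => by
    ext i : 1; fin_cases i <;> rfl
  simp_rw [h1, h2]
  have := sum_perm_fin_three fun i j k => θ ![![a, b, c] i] * β ![![a, b, c] j, ![a, b, c] k]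
  simp only [smul_eq_mul] at this
  rw [this]
  simp only [Matrix.cons_val]
  rw [alt_swap β b a, alt_swap β c a, alt_swap β c b]
  norm_num [Nat.factorial]
  ring

theorem wedgeHom_two_one (β : Alt n 2) (θ : Alt n 1) (a b c : E n) :
    wedgeHom rfl β θ ![a, b, c] =
      θ ![a] * β ![b, c] - θ ![b] * β ![a, c] + θ ![c] * β ![a, b] := by
  rw [wedgeHom_apply]
  have h1 : ∀ σ : Equiv.Perm (Fin 3),
      (fun i : Fin 2 => ![a, b, c] (σ (Fin.cast rfl (Fin.castAdd 1 i)))) =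
        ![![a, b, c] (σ 0), ![a, b, c] (σ 1)] := fun σ => by
    ext i : 1; fin_cases i <;> rfl
  have h2 : ∀ σ : Equiv.Perm (Fin 3),
      (fun i : Fin 1 => ![a, b, c] (σ (Fin.cast rfl (Fin.natAdd 2 i)))) =
        ![![a, b, c] (σ 2)] := fun σ => by
    ext i : 1; fin_cases i; rfl
  simp_rw [h1, h2]
  have := sum_perm_fin_three fun i j k => β ![![a, b, c] i, ![a, b, c] j] * θ ![![a, b, c] k]
  simp only [smul_eq_mul] at this
  rw [this]
  simp only [Matrix.cons_val]
  rw [alt_swap β b a, alt_swap β c a, alt_swap β c b]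
  norm_num [Nat.factorial]
  ring

theorem wedgeHom_one_one (θ η : Alt n 1) (a b : E n) :
    wedgeHom rfl θ η ![a, b] = θ ![a] * η ![b] - θ ![b] * η ![a] := by
  rw [wedgeHom_apply, Finset.univ_perm_fin_succ, ← Finset.univ_product_univ]
  have h1 : ∀ σ : Equiv.Perm (Fin 2),
      (fun i : Fin 1 => ![a, b] (σ (Fin.cast rfl (Fin.castAdd 1 i)))) =
        ![![a, b] (σ 0)] := fun σ => by
    ext i : 1; fin_cases i; rfl
  have h2 : ∀ σ : Equiv.Perm (Fin 2),
      (fun i : Fin 1 => ![a, b] (σ (Fin.cast rfl (Fin.natAdd 1 i)))) =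
        ![![a, b] (σ 1)] := fun σ => by
    ext i : 1; fin_cases i; rfl
  simp_rw [h1, h2]
  simp only [Finset.sum_map, Finset.sum_product, Fin.sum_univ_succ, Finset.univ_unique,
    Finset.sum_singleton, Equiv.toEmbedding_apply]
  simp
  ring

/-! ### Contractions -/

theorem interiorProd_apply (v : E n) (τ : Ext n) (k : ℕ) (w : Fin k → E n) :
    interiorProd v τ k w = τ (k + 1) (Matrix.vecCons v w) := rfl

theorem contract_apply (Z : MV n 2) (τ : Ext n) (k : ℕ) (w : Fin k → E n) :
    contract Z τ k w = (1 / 2 : ℝ) * ∑ i, ∑ j, Z ![dx i, dx j] *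
      τ (k + 2) (Matrix.vecCons (e j) (Matrix.vecCons (e i) w)) := by
  simp [contract, interiorProd_apply, ContinuousAlternatingMap.sum_apply]

theorem contract_apply_eq_zero (Z : MV n 2) {τ : Ext n} {k : ℕ} (h : τ (k + 2) = 0) :
    contract Z τ k = 0 := by
  ext w
  simp [contract_apply, h]

theorem eq_sum_dx (η : Cov n) : η = ∑ i, η (e i) • dx i := by
  ext v
  conv_lhs => rw [← (EuclideanSpace.basisFun (Fin n) ℝ).sum_repr v]
  simp [dx, e, mul_comm]

theorem eq_sum_e (v : E n) : v = ∑ i, dx i v • e i := by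
  conv_lhs => rw [← (EuclideanSpace.basisFun (Fin n) ℝ).sum_repr v]
  simp [dx, e]

/-- A bivector evaluated on two covectors, expanded in coordinates. -/
theorem biv_eq_sum (Z : MV n 2) (ξ η : Cov n) :
    Z ![ξ, η] = ∑ i, ∑ j, Z ![dx i, dx j] * (ξ (e i) * η (e j)) := by
  have h : ∀ ξ η : Cov n, Z ![ξ, η] = ∑ j, Z ![ξ, dx j] * η (e j) := fun ξ η => by
    rw [← apply_bivSharp, bivSharp]
    simp
  rw [h]
  simp_rw [alt_swap Z ξ, h _ ξ]
  rw [Finset.sum_comm]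
  refine Finset.sum_congr rfl fun j _ => ?_
  rw [neg_mul, Finset.sum_mul, ← Finset.sum_neg_distrib]
  refine Finset.sum_congr rfl fun i _ => ?_
  rw [alt_swap Z (dx i)]
  ring

/-! ### Regularity of maps into spaces of alternating forms -/

section Regularity

variable {V : Type*} [NormedAddCommGroup V] [NormedSpace ℝ V] [FiniteDimensional ℝ V]
  {G : Type*} [NormedAddCommGroup G] [NormedSpace ℝ G] {k : ℕ}

variable (V k) in
/-- An alternating form on a finite-dimensional space depends linearly and continuously on the
finite family of its values on basis vectors. -/
theorem exists_alt_of_values : ∃ (ι : Type) (_ : Fintype ι) (v : ι → Fin k → V)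
    (g : (ι → ℝ) →L[ℝ] V [⋀^Fin k]→L[ℝ] ℝ), ∀ α, g (fun i => α (v i)) = α := by
  let B := Module.finBasis ℝ V
  let v : (Fin k → Fin (Module.finrank ℝ V)) → Fin k → V := fun s j => B (s j)
  let L : (V [⋀^Fin k]→L[ℝ] ℝ) →ₗ[ℝ] ((Fin k → Fin (Module.finrank ℝ V)) → ℝ) :=
    { toFun := fun α i => α (v i)
      map_add' := fun _ _ => rfl
      map_smul' := fun _ _ => rfl }
  have hL : LinearMap.ker L = ⊥ := by
    refine LinearMap.ker_eq_bot.2 fun α β h => ?_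
    apply ContinuousAlternatingMap.toAlternatingMap_injective
    apply AlternatingMap.coe_multilinearMap_injective
    exact Module.Basis.ext_multilinear (fun _ => B) fun s => congrFun h s
  obtain ⟨g, hg⟩ := L.exists_leftInverse_of_injective hL
  exact ⟨_, inferInstance, v, LinearMap.toContinuousLinearMap g, fun α => LinearMap.congr_fun hg α⟩

theorem contDiffOn_alt {f : G → V [⋀^Fin k]→L[ℝ] ℝ} {s : Set G} {r : WithTop ℕ∞}
    (h : ∀ v, ContDiffOn ℝ r (fun y => f y v) s) : ContDiffOn ℝ r f s := by
  obtain ⟨ι, _, v, g, hg⟩ := exists_alt_of_values V k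
  have : f = g ∘ fun y i => f y (v i) := funext fun y => (hg (f y)).symm
  rw [this]
  exact g.contDiff.comp_contDiffOn (contDiffOn_pi.2 fun i => h (v i))

theorem differentiableAt_alt {f : G → V [⋀^Fin k]→L[ℝ] ℝ} {y : G}
    (h : ∀ v, DifferentiableAt ℝ (fun y => f y v) y) : DifferentiableAt ℝ f y := by
  obtain ⟨ι, _, v, g, hg⟩ := exists_alt_of_values V k
  have : f = g ∘ fun y i => f y (v i) := funext fun y => (hg (f y)).symm
  rw [this]
  exact g.differentiableAt.comp y (differentiableAt_pi.2 fun i => h (v i))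

omit [FiniteDimensional ℝ V] in
theorem hasFDerivAt_alt_apply {f : G → V [⋀^Fin k]→L[ℝ] ℝ} {y : G}
    (h : DifferentiableAt ℝ f y) (v : Fin k → V) :
    HasFDerivAt (fun y => f y v) ((ContinuousAlternatingMap.apply ℝ V ℝ v) ∘L fderiv ℝ f y) y :=
  (ContinuousAlternatingMap.apply ℝ V ℝ v).hasFDerivAt.comp y h.hasFDerivAt

omit [FiniteDimensional ℝ V] in
theorem fderiv_alt_apply {f : G → V [⋀^Fin k]→L[ℝ] ℝ} {y : G}
    (h : DifferentiableAt ℝ f y) (v : Fin k → V) (a : G) :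
    fderiv ℝ f y a v = fderiv ℝ (fun y => f y v) y a := by
  rw [(hasFDerivAt_alt_apply h v).fderiv]
  rfl

end Regularity

/-! ### Low-degree values of the antisymmetrization -/

section Alternatize

variable {V : Type*} [NormedAddCommGroup V] [NormedSpace ℝ V]

open ContinuousAlternatingMap

theorem alternatizeUncurryFin_apply_one (f : V →L[ℝ] V [⋀^Fin 0]→L[ℝ] ℝ) (u : V) :
    alternatizeUncurryFin f ![u] = f u ![] := by
  rw [alternatizeUncurryFin_apply]
  simp

theorem alternatizeUncurryFin_apply_three (f : V →L[ℝ] V [⋀^Fin 2]→L[ℝ] ℝ) (u v w : V) :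
    alternatizeUncurryFin f ![u, v, w] = f u ![v, w] - f v ![u, w] + f w ![u, v] := by
  have h0 : (0 : Fin 3).removeNth ![u, v, w] = ![v, w] := by ext i : 1; fin_cases i <;> rfl
  have h1 : (1 : Fin 3).removeNth ![u, v, w] = ![u, w] := by ext i : 1; fin_cases i <;> rfl
  have h2 : (2 : Fin 3).removeNth ![u, v, w] = ![u, v] := by ext i : 1; fin_cases i <;> rfl
  rw [alternatizeUncurryFin_apply, Fin.sum_univ_three, h0, h1, h2]
  simp
  ring

theorem alternatizeUncurryFin_apply_five (f : V →L[ℝ] V [⋀^Fin 4]→L[ℝ] ℝ) (a b u v w : V) :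
    alternatizeUncurryFin f ![a, b, u, v, w] = f a ![b, u, v, w] - f b ![a, u, v, w] +
      f u ![a, b, v, w] - f v ![a, b, u, w] + f w ![a, b, u, v] := by
  have h0 : (0 : Fin 5).removeNth ![a, b, u, v, w] = ![b, u, v, w] := by
    ext i : 1; fin_cases i <;> rfl
  have h1 : (1 : Fin 5).removeNth ![a, b, u, v, w] = ![a, u, v, w] := by
    ext i : 1; fin_cases i <;> rfl
  have h2 : (2 : Fin 5).removeNth ![a, b, u, v, w] = ![a, b, v, w] := by
    ext i : 1; fin_cases i <;> rfl
  have h3 : (3 : Fin 5).removeNth ![a, b, u, v, w] = ![a, b, u, w] := by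
    ext i : 1; fin_cases i <;> rfl
  have h4 : (4 : Fin 5).removeNth ![a, b, u, v, w] = ![a, b, u, v] := by
    ext i : 1; fin_cases i <;> rfl
  rw [alternatizeUncurryFin_apply, Fin.sum_univ_five, h0, h1, h2, h3, h4]
  simp
  ring

end Alternatize

/-! ### Pullback along a linear isomorphism -/

/-- The full contraction `∑ᵢⱼ Z(dxⁱ, dxʲ) β(eⱼ, eᵢ)`, which is `2 ι_Z β`. -/
noncomputable def pairing (Z : MV n 2) (β : Alt n 2) : ℝ :=
  ∑ i, ∑ j, Z ![dx i, dx j] * β ![e j, e i]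

/-- The form `(v, w) ↦ Z(β♯ v, β♯ w)`. -/
noncomputable def twist (Z : MV n 2) (β : Alt n 2) : Alt n 2 :=
  Z.compContinuousLinearMap (formSharp β)

theorem twist_apply (Z : MV n 2) (β : Alt n 2) (v w : E n) :
    twist Z β ![v, w] = Z ![formSharp β v, formSharp β w] := by
  change Z _ = Z _
  congr 1
  ext i : 1; fin_cases i <;> rfl

theorem twist_eq_sum (Z : MV n 2) (β : Alt n 2) (v w : E n) :
    twist Z β ![v, w] = ∑ i, ∑ j, Z ![dx i, dx j] * (β ![v, e i] * β ![w, e j]) := by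
  rw [twist_apply, biv_eq_sum]
  simp_rw [formSharp_apply]

/-- The contraction is a trace, hence independent of the basis. -/
theorem pairing_eq_trace (Z : MV n 2) (β : Alt n 2) :
    pairing Z β = LinearMap.trace ℝ (E n) (bivSharp Z ∘L formSharp β : E n →L[ℝ] E n) := by
  rw [LinearMap.trace_eq_matrix_trace ℝ (EuclideanSpace.basisFun (Fin n) ℝ).toBasis,
    Matrix.trace, pairing, Finset.sum_comm]
  refine Finset.sum_congr rfl fun j _ => ?_
  have : Matrix.diag (LinearMap.toMatrix (EuclideanSpace.basisFun (Fin n) ℝ).toBasis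
      (EuclideanSpace.basisFun (Fin n) ℝ).toBasis
      ((bivSharp Z ∘L formSharp β : E n →L[ℝ] E n) : E n →ₗ[ℝ] E n)) j =
      dx j (bivSharp Z (formSharp β (e j))) := by
    simp [LinearMap.toMatrix_apply, dx, e]
  rw [this, apply_bivSharp, biv_eq_sum]
  refine Finset.sum_congr rfl fun i _ => ?_
  rw [Finset.sum_eq_single j]
  · simp [dx, e, formSharp_apply]
  · intro k _ hk
    simp [dx, e, hk.symm]
  · simp

theorem compContinuousLinearMap_two {V W : Type*} [NormedAddCommGroup V] [NormedSpace ℝ V]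
    [NormedAddCommGroup W] [NormedSpace ℝ W] (β : W [⋀^Fin 2]→L[ℝ] ℝ) (K : V →L[ℝ] W) (v w : V) :
    β.compContinuousLinearMap K ![v, w] = β ![K v, K w] := by
  change β _ = β _
  congr 1
  ext i : 1; fin_cases i <;> rfl

theorem formSharp_comp (β : Alt n 2) (K : E n →L[ℝ] E n) (v : E n) :
    formSharp (β.compContinuousLinearMap K) v = formSharp β (K v) ∘L K := by
  ext w
  rw [formSharp_apply, compContinuousLinearMap_two, ContinuousLinearMap.comp_apply,
    formSharp_apply]

theorem bivSharp_precomp (Z : MV n 2) (K : E n →L[ℝ] E n) (ξ : Cov n) :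
    bivSharp (Z.compContinuousLinearMap (ContinuousLinearMap.precomp ℝ K)) ξ =
      K (bivSharp Z (ξ ∘L K)) := by
  have h : ∀ η : Cov n,
      η (bivSharp (Z.compContinuousLinearMap (ContinuousLinearMap.precomp ℝ K)) ξ) =
        η (K (bivSharp Z (ξ ∘L K))) := fun η => by
    rw [apply_bivSharp, compContinuousLinearMap_two]
    exact (apply_bivSharp Z (ξ ∘L K) (η ∘L K)).symm
  rw [eq_sum_e (bivSharp _ ξ), eq_sum_e (K _)]
  simp_rw [h]

section Pullback

variable {K K' : E n →L[ℝ] E n} (hK : K ∘L K' = ContinuousLinearMap.id ℝ (E n))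
include hK

theorem formSharp_comp_comp (β : Alt n 2) (v : E n) :
    formSharp (β.compContinuousLinearMap K) v ∘L K' = formSharp β (K v) := by
  rw [formSharp_comp, ContinuousLinearMap.comp_assoc, hK, ContinuousLinearMap.comp_id]

theorem bivSharp_formSharp_pullback (Z : MV n 2) (β : Alt n 2) (v : E n) :
    bivSharp (Z.compContinuousLinearMap (ContinuousLinearMap.precomp ℝ K'))
      (formSharp (β.compContinuousLinearMap K) v) = K' (bivSharp Z (formSharp β (K v))) := by
  rw [bivSharp_precomp, formSharp_comp_comp hK]

theorem twist_pullback (Z : MV n 2) (β : Alt n 2) :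
    twist (Z.compContinuousLinearMap (ContinuousLinearMap.precomp ℝ K'))
      (β.compContinuousLinearMap K) = (twist Z β).compContinuousLinearMap K := by
  refine alt_ext_two fun v w => ?_
  rw [twist_apply, compContinuousLinearMap_two, compContinuousLinearMap_two, twist_apply,
    ← formSharp_comp_comp hK, ← formSharp_comp_comp hK]
  rfl

theorem pairing_pullback (Z : MV n 2) (β : Alt n 2) :
    pairing (Z.compContinuousLinearMap (ContinuousLinearMap.precomp ℝ K'))
      (β.compContinuousLinearMap K) = pairing Z β := by
  rw [pairing_eq_trace, pairing_eq_trace]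
  have : ((bivSharp (Z.compContinuousLinearMap (ContinuousLinearMap.precomp ℝ K')) ∘L
      formSharp (β.compContinuousLinearMap K) : E n →L[ℝ] E n) : E n →ₗ[ℝ] E n) =
      (K' : E n →ₗ[ℝ] E n) * (((bivSharp Z ∘L formSharp β : E n →L[ℝ] E n) : E n →ₗ[ℝ] E n) *
        (K : E n →ₗ[ℝ] E n)) := by
    ext1 v
    exact bivSharp_formSharp_pullback hK Z β v
  rw [this, LinearMap.trace_mul_comm, mul_assoc]
  congr 1
  have h : (K : E n →ₗ[ℝ] E n) * (K' : E n →ₗ[ℝ] E n) = 1 := by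
    ext1 v
    exact DFunLike.congr_fun hK v
  rw [h, mul_one]

variable (hK' : K' ∘L K = ContinuousLinearMap.id ℝ (E n))
include hK'

/-- Naturality of `id + Z♯ β♯`: pulling `β` back along `K` and pushing `Z` forward along
`K' = K⁻¹` conjugates it by `K`. -/
theorem one_add_sharp_pullback (Z : MV n 2) (β : Alt n 2) :
    (1 + bivSharp (Z.compContinuousLinearMap (ContinuousLinearMap.precomp ℝ K')) ∘L
      formSharp (β.compContinuousLinearMap K) : E n →L[ℝ] E n) =
    K' ∘L (1 + bivSharp Z ∘L formSharp β : E n →L[ℝ] E n) ∘L K := by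
  ext1 v
  have h := DFunLike.congr_fun hK' v
  simp only [ContinuousLinearMap.comp_apply, ContinuousLinearMap.id_apply] at h
  simp only [add_apply, ContinuousLinearMap.comp_apply,
    one_apply_eq_self, bivSharp_formSharp_pullback hK, map_add, h]

theorem mem_invSet_pullback (Z : MV n 2) (β : Alt n 2) :
    β.compContinuousLinearMap K ∈
      invSet (Z.compContinuousLinearMap (ContinuousLinearMap.precomp ℝ K')) ↔ β ∈ invSet Z := by
  let U : (E n →L[ℝ] E n)ˣ := ⟨K, K', hK, hK'⟩
  change IsUnit (1 + _ : E n →L[ℝ] E n) ↔ IsUnit (1 + _ : E n →L[ℝ] E n)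
  rw [one_add_sharp_pullback hK hK']
  change IsUnit ((↑U⁻¹ : E n →L[ℝ] E n) * (_ * (U : E n →L[ℝ] E n))) ↔ _
  rw [Units.isUnit_units_mul, Units.isUnit_mul_units]

end Pullback

/-! ### The gauge-transformed form `F(β)` -/

/-- The defining property `F(β)♯ ∘ (id + Z♯ β♯) = β♯`. -/
theorem F_apply (Z : MV n 2) (β : Alt n 2) (hβ : β ∈ invSet Z) (v w : E n) :
    F Z β hβ ![v + bivSharp Z (formSharp β v), w] = β ![v, w] := by
  rw [← formSharp_apply, formSharp_F, ← formSharp_apply]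
  have : v + bivSharp Z (formSharp β v) = (1 + bivSharp Z ∘L formSharp β : E n →L[ℝ] E n) v := rfl
  rw [this, ContinuousLinearMap.comp_apply, ← mul_apply_eq_comp, Ring.inverse_mul_cancel _ hβ]
  rfl

theorem exists_add_sharp_eq {Z : MV n 2} {β : Alt n 2} (hβ : β ∈ invSet Z) (w : E n) :
    ∃ v, v + bivSharp Z (formSharp β v) = w :=
  ⟨_, DFunLike.congr_fun (Ring.mul_inverse_cancel _ hβ) w⟩

theorem eq_F {Z : MV n 2} {β γ : Alt n 2} (hβ : β ∈ invSet Z)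
    (h : ∀ v w, γ ![v + bivSharp Z (formSharp β v), w] = β ![v, w]) : γ = F Z β hβ := by
  refine alt_ext_two fun a w => ?_
  obtain ⟨v, rfl⟩ := exists_add_sharp_eq hβ a
  rw [h, F_apply]

theorem F_pullback {K K' : E n →L[ℝ] E n} (hK : K ∘L K' = ContinuousLinearMap.id ℝ (E n))
    (Z : MV n 2) (β : Alt n 2) (hβ : β ∈ invSet Z)
    (hβ' : β.compContinuousLinearMap K ∈
      invSet (Z.compContinuousLinearMap (ContinuousLinearMap.precomp ℝ K'))) :
    (F Z β hβ).compContinuousLinearMap K =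
      F (Z.compContinuousLinearMap (ContinuousLinearMap.precomp ℝ K'))
        (β.compContinuousLinearMap K) hβ' := by
  refine eq_F _ fun v w => ?_
  rw [compContinuousLinearMap_two, bivSharp_formSharp_pullback hK, map_add,
    compContinuousLinearMap_two]
  have h : ∀ x, K (K' x) = x := DFunLike.congr_fun hK
  rw [h, F_apply]

/-! ### Sharp maps as continuous linear maps -/

instance {V : Type*} [NormedAddCommGroup V] [NormedSpace ℝ V] [FiniteDimensional ℝ V] (k : ℕ) :
    FiniteDimensional ℝ (V [⋀^Fin k]→L[ℝ] ℝ) := by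
  obtain ⟨ι, _, v, g, hg⟩ := exists_alt_of_values V k
  exact Module.Finite.of_surjective (g : (ι → ℝ) →ₗ[ℝ] V [⋀^Fin k]→L[ℝ] ℝ) fun α => ⟨_, hg α⟩

/-- `β ↦ β♯` as a continuous linear map. -/
noncomputable def formSharpL (n : ℕ) : Alt n 2 →L[ℝ] E n →L[ℝ] Cov n :=
  LinearMap.toContinuousLinearMap
    { toFun := formSharp
      map_add' := fun α β => by ext v w; simp [formSharp_apply]
      map_smul' := fun c α => by ext v w; simp [formSharp_apply] }

/-- `Z ↦ Z♯` as a continuous linear map. -/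
noncomputable def bivSharpL (n : ℕ) : MV n 2 →L[ℝ] Cov n →L[ℝ] E n :=
  LinearMap.toContinuousLinearMap
    { toFun := bivSharp
      map_add' := fun Z W => by
        ext1 ξ
        change ∑ i, (Z + W) ![ξ, dx i] • e i =
          (∑ i, Z ![ξ, dx i] • e i) + ∑ i, W ![ξ, dx i] • e i
        simp [add_smul, Finset.sum_add_distrib]
      map_smul' := fun c Z => by
        ext1 ξ
        change ∑ i, (c • Z) ![ξ, dx i] • e i = c • ∑ i, Z ![ξ, dx i] • e i
        simp [Finset.smul_sum, smul_smul] }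

theorem formSharpL_apply (β : Alt n 2) : formSharpL n β = formSharp β := rfl

theorem bivSharpL_apply (Z : MV n 2) : bivSharpL n Z = bivSharp Z := rfl

/-! ### Contraction of a two-form and of its square -/

/-- `ι_Z` on forms of degree `k + 2`; on forms of degree `0` and `1` it vanishes. -/
noncomputable def contractHom {k : ℕ} (Z : MV n 2) (σ : Alt n (k + 2)) : Alt n k :=
  contract Z (Pi.single (k + 2) σ) k

theorem contractHom_apply {k : ℕ} (Z : MV n 2) (σ : Alt n (k + 2)) (w : Fin k → E n) :
    contractHom Z σ w = (1 / 2 : ℝ) * ∑ i, ∑ j, Z ![dx i, dx j] *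
      σ (Matrix.vecCons (e j) (Matrix.vecCons (e i) w)) := by
  rw [contractHom, contract_apply, Pi.single_eq_same]

theorem contract_single {k : ℕ} (Z : MV n 2) (σ : Alt n (k + 2)) :
    contract Z (Pi.single (k + 2) σ) = Pi.single k (contractHom Z σ) := by
  funext m
  by_cases h : m = k
  · subst h
    rw [Pi.single_eq_same, contractHom]
  · rw [Pi.single_eq_of_ne h, contract_apply_eq_zero]
    rw [Pi.single_eq_of_ne (by omega)]

theorem contractHom_two_apply (Z : MV n 2) (β : Alt n 2) (w : Fin 0 → E n) :
    contractHom Z β w = (1 / 2 : ℝ) * pairing Z β := by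
  rw [contractHom_apply, pairing, Subsingleton.elim w ![]]

/-- `½ ι_Z (β ∧ β)` is `(ι_Z β) β` plus the form `Z(β♯ ·, β♯ ·)`. -/
theorem contractHom_wedge_self (Z : MV n 2) (β : Alt n 2) :
    contractHom Z (wedgeHom rfl β β) = pairing Z β • β + (2 : ℝ) • twist Z β := by
  refine alt_ext_two fun v w => ?_
  rw [contractHom_apply]
  have h : ∀ i j, wedgeHom rfl β β ![e j, e i, v, w] = 2 * (β ![e j, e i] * β ![v, w]) +
      2 * (β ![v, e i] * β ![w, e j]) - 2 * (β ![v, e j] * β ![w, e i]) := fun i j => by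
    rw [wedgeHom_two_two, alt_swap β (e j) v, alt_swap β (e j) w, alt_swap β (e i) v,
      alt_swap β (e i) w]
    ring
  have h' : ∑ i, ∑ j, Z ![dx i, dx j] * (β ![v, e j] * β ![w, e i]) = -twist Z β ![v, w] := by
    rw [twist_eq_sum, Finset.sum_comm]
    simp_rw [← Finset.sum_neg_distrib, ← neg_mul, ← alt_swap]
  change (1 / 2 : ℝ) * ∑ i, ∑ j, Z ![dx i, dx j] * wedgeHom rfl β β ![e j, e i, v, w] = _
  simp_rw [h, mul_sub, mul_add, Finset.sum_sub_distrib, Finset.sum_add_distrib,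
    mul_left_comm _ (2 : ℝ), ← Finset.mul_sum]
  rw [h', ← twist_eq_sum]
  simp_rw [← mul_assoc, ← Finset.sum_mul]
  rw [← pairing]
  simp
  ring

/-- Summation of the coefficients of `Z` against a matrix. -/
noncomputable def coeffSum (Z : MV n 2) : (Fin n → Fin n → ℝ) →ₗ[ℝ] ℝ where
  toFun f := ∑ i, ∑ j, Z ![dx i, dx j] * f i j
  map_add' f g := by simp [mul_add, Finset.sum_add_distrib]
  map_smul' c f := by simp [Finset.mul_sum, mul_left_comm]

/-- Only the antisymmetric part of a matrix is seen by `coeffSum Z`. -/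
theorem coeffSum_congr (Z : MV n 2) {f g : Fin n → Fin n → ℝ}
    (h : ∀ i j, f i j - f j i = g i j - g j i) : coeffSum Z f = coeffSum Z g := by
  have key : ∀ f : Fin n → Fin n → ℝ,
      2 * coeffSum Z f = ∑ i, ∑ j, Z ![dx i, dx j] * (f i j - f j i) := fun f => by
    have : ∑ i, ∑ j, Z ![dx i, dx j] * f j i = -coeffSum Z f := by
      rw [Finset.sum_comm]
      change _ = -∑ i, ∑ j, Z ![dx i, dx j] * f i j
      simp_rw [← Finset.sum_neg_distrib, ← neg_mul, ← alt_swap]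
    simp_rw [mul_sub, Finset.sum_sub_distrib]
    rw [this]
    change _ = coeffSum Z f - _
    ring
  have := key f
  simp_rw [h] at this
  rw [← key g] at this
  linarith

/-! ### Derivatives of `β ∧ β` and of its contraction -/

section Model

variable {P : E n → MV n 2} {b : E n → Alt n 2} {y : E n}

theorem differentiableAt_wedgeHom_self (hb : DifferentiableAt ℝ b y) :
    DifferentiableAt ℝ (fun z => wedgeHom rfl (b z) (b z)) y := by
  refine differentiableAt_alt fun v => ?_
  have h : v = ![v 0, v 1, v 2, v 3] := by ext i : 1; fin_cases i <;> rfl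
  rw [h]
  simp_rw [wedgeHom_two_two]
  have := fun v w => (hasFDerivAt_alt_apply hb ![v, w]).differentiableAt
  fun_prop (disch := assumption)

theorem fderiv_wedgeHom_self (hb : DifferentiableAt ℝ b y) (a p q r s : E n) :
    fderiv ℝ (fun z => wedgeHom rfl (b z) (b z)) y a ![p, q, r, s] =
      2 * wedgeHom rfl (fderiv ℝ b y a) (b y) ![p, q, r, s] := by
  rw [fderiv_alt_apply (differentiableAt_wedgeHom_self hb)]
  simp_rw [wedgeHom_two_two]
  have h := fun v w => hasFDerivAt_alt_apply hb ![v, w]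
  have H := ((((h p q).mul (h r s)).sub ((h p r).mul (h q s))).add ((h p s).mul (h q r)))
  have H2 := (H.add H).fderiv
  refine (DFunLike.congr_fun H2 a).trans ?_
  simp
  ring

theorem hasFDerivAt_pairing (hP : DifferentiableAt ℝ P y) (hb : DifferentiableAt ℝ b y) :
    ∃ L : E n →L[ℝ] ℝ, HasFDerivAt (fun z => pairing (P z) (b z)) L y ∧
      ∀ a, L a = pairing (fderiv ℝ P y a) (b y) + pairing (P y) (fderiv ℝ b y a) := by
  have h := fun i j : Fin n => (hasFDerivAt_alt_apply hP ![dx i, dx j]).mul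
    (hasFDerivAt_alt_apply hb ![e j, e i])
  refine ⟨_, HasFDerivAt.fun_sum (u := Finset.univ) fun i _ =>
    HasFDerivAt.fun_sum (u := Finset.univ) fun j _ => h i j, fun a => ?_⟩
  simp [pairing, ← Finset.sum_add_distrib]
  refine Finset.sum_congr rfl fun i _ => Finset.sum_congr rfl fun j _ => ?_
  ring

theorem hasFDerivAt_twist_apply (hP : DifferentiableAt ℝ P y) (hb : DifferentiableAt ℝ b y)
    (v w : E n) :
    ∃ L : E n →L[ℝ] ℝ, HasFDerivAt (fun z => twist (P z) (b z) ![v, w]) L y ∧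
      ∀ a, L a = twist (fderiv ℝ P y a) (b y) ![v, w] +
        coeffSum (P y) (fun i j => fderiv ℝ b y a ![v, e i] * b y ![w, e j]) +
        coeffSum (P y) (fun i j => b y ![v, e i] * fderiv ℝ b y a ![w, e j]) := by
  simp_rw [twist_eq_sum]
  have h := fun i j : Fin n => (hasFDerivAt_alt_apply hP ![dx i, dx j]).mul
    ((hasFDerivAt_alt_apply hb ![v, e i]).mul (hasFDerivAt_alt_apply hb ![w, e j]))
  refine ⟨_, HasFDerivAt.fun_sum (u := Finset.univ) fun i _ =>
    HasFDerivAt.fun_sum (u := Finset.univ) fun j _ => h i j, fun a => ?_⟩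
  simp [coeffSum, ← Finset.sum_add_distrib]
  refine Finset.sum_congr rfl fun i _ => Finset.sum_congr rfl fun j _ => ?_
  ring

theorem differentiableAt_twist (hP : DifferentiableAt ℝ P y) (hb : DifferentiableAt ℝ b y) :
    DifferentiableAt ℝ (fun z => twist (P z) (b z)) y := by
  refine differentiableAt_alt fun v => ?_
  have h : v = ![v 0, v 1] := by ext i : 1; fin_cases i <;> rfl
  rw [h]
  obtain ⟨L, hL, -⟩ := hasFDerivAt_twist_apply hP hb (v 0) (v 1)
  exact hL.differentiableAt

theorem fderiv_pairing_smul_add_twist (hP : DifferentiableAt ℝ P y) (hb : DifferentiableAt ℝ b y)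
    (a v w : E n) :
    fderiv ℝ (fun z => pairing (P z) (b z) • b z + (2 : ℝ) • twist (P z) (b z)) y a ![v, w] =
      fderiv ℝ (fun z => pairing (P z) (b z)) y a * b y ![v, w] +
      pairing (P y) (b y) * fderiv ℝ b y a ![v, w] +
      2 * (twist (fderiv ℝ P y a) (b y) ![v, w] +
        coeffSum (P y) (fun i j => fderiv ℝ b y a ![v, e i] * b y ![w, e j]) +
        coeffSum (P y) (fun i j => b y ![v, e i] * fderiv ℝ b y a ![w, e j])) := by
  obtain ⟨L, hL, -⟩ := hasFDerivAt_pairing hP hb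
  obtain ⟨L', hL', hL''⟩ := hasFDerivAt_twist_apply hP hb v w
  have ht := differentiableAt_twist hP hb
  have hd : DifferentiableAt ℝ
      (fun z => pairing (P z) (b z) • b z + (2 : ℝ) • twist (P z) (b z)) y :=
    (hL.differentiableAt.smul hb).add (ht.const_smul (2 : ℝ))
  rw [fderiv_alt_apply hd, hL.fderiv, ← hL'']
  have H := ((hL.mul (hasFDerivAt_alt_apply hb ![v, w])).add (hL'.const_mul 2)).fderiv
  refine (DFunLike.congr_fun H a).trans ?_
  simp
  ring

/-- The polynomial identity behind `½ λ₂(β, β)`: the terms of `½ λ₂(β, β)` that differentiate `β`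
but not `Z` add up to the derivative of `β` in the directions `Z♯ β♯ ·`. -/
theorem coeffSum_identity (Z : MV n 2) (B : Alt n 2) (D : E n → Alt n 2) (u v w : E n) :
    coeffSum Z (fun i j =>
      -(1 / 2 : ℝ) * (wedgeHom rfl (D (e j)) B ![e i, u, v, w] -
        wedgeHom rfl (D (e i)) B ![e j, u, v, w] + wedgeHom rfl (D u) B ![e j, e i, v, w] -
        wedgeHom rfl (D v) B ![e j, e i, u, w] + wedgeHom rfl (D w) B ![e j, e i, u, v]) +
      (1 / 2 : ℝ) * (B ![e j, e i] * (D u ![v, w] - D v ![u, w] + D w ![u, v])) +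
      ((D u ![v, e i] * B ![w, e j] + B ![v, e i] * D u ![w, e j]) -
        (D v ![u, e i] * B ![w, e j] + B ![u, e i] * D v ![w, e j]) +
        (D w ![u, e i] * B ![v, e j] + B ![u, e i] * D w ![v, e j])) +
      (1 / 2 : ℝ) *
        ((D (e j) ![e i, u] - D (e i) ![e j, u] + D u ![e j, e i]) * B ![v, w] -
        (D (e j) ![e i, v] - D (e i) ![e j, v] + D v ![e j, e i]) * B ![u, w] +
        (D (e j) ![e i, w] - D (e i) ![e j, w] + D w ![e j, e i]) * B ![u, v])) =
    coeffSum Z (fun i j => B ![u, e i] * D (e j) ![v, w] - B ![v, e i] * D (e j) ![u, w] +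
      B ![w, e i] * D (e j) ![u, v]) := by
  refine coeffSum_congr Z fun i j => ?_
  simp only [wedgeHom_two_two]
  -- After ordering the arguments of the two-forms, the identity holds for arbitrary vectors.
  generalize e i = p
  generalize e j = q
  simp only [fun γ : Alt n 2 => alt_swap γ q p, fun γ : Alt n 2 => alt_swap γ u p,
    fun γ : Alt n 2 => alt_swap γ v p, fun γ : Alt n 2 => alt_swap γ w p,
    fun γ : Alt n 2 => alt_swap γ u q, fun γ : Alt n 2 => alt_swap γ v q,
    fun γ : Alt n 2 => alt_swap γ w q]
  ring

end Model

/-! ### The exterior derivative of `F(β)` in coordinates -/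

theorem hasFDerivAt_formSharpL {f : E n → Alt n 2} {y : E n} (hf : DifferentiableAt ℝ f y) :
    HasFDerivAt (fun z => formSharpL n (f z)) (formSharpL n ∘L fderiv ℝ f y) y :=
  HasFDerivAt.comp (𝕜 := ℝ) (E := E n) (F := Alt n 2) (G := E n →L[ℝ] Cov n) y
    (ContinuousLinearMap.hasFDerivAt (𝕜 := ℝ) (E := Alt n 2) (F := E n →L[ℝ] Cov n)
    (formSharpL n)) hf.hasFDerivAt

theorem hasFDerivAt_bivSharpL {f : E n → MV n 2} {y : E n} (hf : DifferentiableAt ℝ f y) :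
    HasFDerivAt (fun z => bivSharpL n (f z)) (bivSharpL n ∘L fderiv ℝ f y) y :=
  HasFDerivAt.comp (𝕜 := ℝ) (E := E n) (F := MV n 2) (G := Cov n →L[ℝ] E n) y
    (ContinuousLinearMap.hasFDerivAt (𝕜 := ℝ) (E := MV n 2) (F := Cov n →L[ℝ] E n)
    (bivSharpL n)) hf.hasFDerivAt

section Model

variable {P : E n → MV n 2} {b : E n → Alt n 2} {y : E n}

/-- The expression `(D_a β)(v, w) + (D_a Z)(β♯ v, β♯ w)`, for a bivector field `Z = P` and a
two-form `β = b` on `ℝⁿ`. It turns out to be `(D_a F(β))(A v, A w)` for `A = id + Z♯ β♯`. -/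
noncomputable def gaugeDeriv (P : E n → MV n 2) (b : E n → Alt n 2) (y : E n) (a v w : E n) : ℝ :=
  fderiv ℝ b y a ![v, w] + fderiv ℝ P y a ![formSharp (b y) v, formSharp (b y) w]

theorem hasFDerivAt_one_add_sharp (hP : DifferentiableAt ℝ P y) (hb : DifferentiableAt ℝ b y) :
    ∃ L : E n →L[ℝ] E n →L[ℝ] E n,
      HasFDerivAt (fun z => (1 + bivSharpL n (P z) ∘L formSharpL n (b z) : E n →L[ℝ] E n)) L y ∧
      ∀ a v, L a v = bivSharp (fderiv ℝ P y a) (formSharp (b y) v) +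
        bivSharp (P y) (formSharp (fderiv ℝ b y a) v) := by
  refine ⟨_, ((hasFDerivAt_bivSharpL hP).clm_comp (hasFDerivAt_formSharpL hb)).const_add 1, fun a v => ?_⟩
  simp [formSharpL_apply, bivSharpL_apply]
  exact add_comm _ _

/-- Differentiating `F(β)♯ ∘ A = β♯`, where `A = id + Z♯ β♯`. -/
theorem fderiv_apply_add_sharp {G : E n → Alt n 2} (hP : DifferentiableAt ℝ P y)
    (hb : DifferentiableAt ℝ b y) (hG : DifferentiableAt ℝ G y)
    (h : ∀ᶠ z in nhds y, ∀ v w, G z ![v + bivSharp (P z) (formSharp (b z) v), w] = b z ![v, w])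
    (a v w : E n) :
    fderiv ℝ G y a ![v + bivSharp (P y) (formSharp (b y) v),
      w + bivSharp (P y) (formSharp (b y) w)] = gaugeDeriv P b y a v w := by
  obtain ⟨L, hL, hLa⟩ := hasFDerivAt_one_add_sharp hP hb
  have h3 := (hasFDerivAt_formSharpL hG).clm_comp hL
  have h4 : (fun z => (formSharpL n (G z)).comp
      (1 + bivSharpL n (P z) ∘L formSharpL n (b z) : E n →L[ℝ] E n)) =ᶠ[nhds y]
      fun z => formSharpL n (b z) := by
    filter_upwards [h] with z hz
    ext v w
    have := hz v w
    rw [← formSharp_apply, ← formSharp_apply] at this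
    exact this
  -- The derivative of the product `F(β)♯ ∘ A` is the derivative of `β♯`.
  have h5 := (hasFDerivAt_formSharpL hb).unique (h3.congr_of_eventuallyEq h4.symm)
  have h6 : ∀ w, fderiv ℝ b y a ![v, w] = G y ![L a v, w] +
      fderiv ℝ G y a ![v + bivSharp (P y) (formSharp (b y) v), w] := fun w => by
    have := DFunLike.congr_fun (DFunLike.congr_fun (DFunLike.congr_fun h5 a) v) w
    simp only [← formSharp_apply]
    simpa [formSharpL_apply, bivSharpL_apply] using this
  have h7 : ∀ x, G y ![x, w + bivSharp (P y) (formSharp (b y) w)] = -b y ![w, x] := fun x => by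
    rw [alt_swap, h.self_of_nhds]
  have h8 := h6 (w + bivSharp (P y) (formSharp (b y) w))
  rw [h7, hLa, ← formSharp_apply, ← formSharp_apply, map_add, map_add, apply_bivSharp,
    apply_bivSharp, apply_bivSharp, alt_swap (P y)] at h8
  rw [gaugeDeriv, ← formSharp_apply (fderiv ℝ b y a)]
  linarith

/-- `dF(β)` evaluated on `A u, A v, A w`, where `A = id + Z♯ β♯`. -/
theorem extDeriv_apply_add_sharp {G : E n → Alt n 2} (hP : DifferentiableAt ℝ P y)
    (hb : DifferentiableAt ℝ b y) (hG : DifferentiableAt ℝ G y)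
    (h : ∀ᶠ z in nhds y, ∀ v w, G z ![v + bivSharp (P z) (formSharp (b z) v), w] = b z ![v, w])
    (u v w : E n) :
    extDeriv G y ![u + bivSharp (P y) (formSharp (b y) u),
      v + bivSharp (P y) (formSharp (b y) v), w + bivSharp (P y) (formSharp (b y) w)] =
    gaugeDeriv P b y (u + bivSharp (P y) (formSharp (b y) u)) v w -
      gaugeDeriv P b y (v + bivSharp (P y) (formSharp (b y) v)) u w +
      gaugeDeriv P b y (w + bivSharp (P y) (formSharp (b y) w)) u v := by
  rw [extDeriv, alternatizeUncurryFin_apply_three]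
  simp_rw [fderiv_apply_add_sharp hP hb hG h]

/-! ### The Maurer–Cartan expression in coordinates -/

theorem schoutenModel_self_apply (ξ η ζ : Cov n) :
    schoutenModel P P y ![ξ, η, ζ] = 2 * (fderiv ℝ P y (bivSharp (P y) ξ) ![η, ζ] -
      fderiv ℝ P y (bivSharp (P y) η) ![ξ, ζ] + fderiv ℝ P y (bivSharp (P y) ζ) ![ξ, η]) := by
  rw [schoutenModel, alternatizeUncurryFin_apply_three]
  simp
  ring

theorem bivSharp_formSharp_eq_sum (Z : MV n 2) (β : Alt n 2) (u : E n) :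
    bivSharp Z (formSharp β u) = ∑ i, ∑ j, (Z ![dx i, dx j] * β ![u, e i]) • e j := by
  rw [eq_sum_e (bivSharp _ _), Finset.sum_comm]
  refine Finset.sum_congr rfl fun j _ => ?_
  rw [apply_bivSharp, biv_eq_sum, ← Finset.sum_smul]
  congr 1
  refine Finset.sum_congr rfl fun i _ => ?_
  rw [Finset.sum_eq_single j]
  · simp [dx, e, formSharp_apply]
  · intro k _ hk
    simp [dx, e, hk.symm]
  · simp

/-- The derivative of a form in the direction `Z♯ β♯ u`, in coordinates. -/
theorem clm_bivSharp_apply (Z : MV n 2) (β : Alt n 2) (D : E n →L[ℝ] Alt n 2) (u v w : E n) :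
    D (bivSharp Z (formSharp β u)) ![v, w] =
      coeffSum Z (fun i j => β ![u, e i] * D (e j) ![v, w]) := by
  rw [bivSharp_formSharp_eq_sum]
  simp [coeffSum, ContinuousAlternatingMap.sum_apply, mul_assoc]

/-- The Maurer–Cartan expression `dβ + ½ λ₂(β, β) + ⅙ λ₃(β, β, β)` in coordinates. The hypothesis
on `θ` says that `θ = 𝓛_Z β`, and the forms in the second and third lines are `ι_Z d(β ∧ β)` and
`d ι_Z (β ∧ β)`. -/
theorem maurerCartan_model (hP : DifferentiableAt ℝ P y) (hb : DifferentiableAt ℝ b y)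
    {θ : Alt n 1} (hθ : ∀ u, θ ![u] = contractHom (P y) (extDeriv b y) ![u] -
      (1 / 2 : ℝ) * fderiv ℝ (fun z => pairing (P z) (b z)) y u) (u v w : E n) :
    extDeriv b y ![u, v, w] - (1 / 2 : ℝ) *
      (contractHom (P y) (extDeriv (fun z => wedgeHom (p := 2) (q := 2) rfl (b z) (b z)) y) ![u, v, w] -
        extDeriv (fun z => pairing (P z) (b z) • b z + (2 : ℝ) • twist (P z) (b z)) y ![u, v, w] -
        2 * wedgeHom rfl θ (b y) ![u, v, w]) +
      (1 / 2 : ℝ) * schoutenModel P P y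
        ![formSharp (b y) u, formSharp (b y) v, formSharp (b y) w] =
    gaugeDeriv P b y (u + bivSharp (P y) (formSharp (b y) u)) v w -
      gaugeDeriv P b y (v + bivSharp (P y) (formSharp (b y) v)) u w +
      gaugeDeriv P b y (w + bivSharp (P y) (formSharp (b y) w)) u v := by
  have h1 : contractHom (P y) (extDeriv (fun z => wedgeHom (p := 2) (q := 2) rfl (b z) (b z)) y) ![u, v, w] =
      (1 / 2 : ℝ) * coeffSum (P y) fun i j =>
        extDeriv (fun z => wedgeHom (p := 2) (q := 2) rfl (b z) (b z)) y ![e j, e i, u, v, w] :=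
    contractHom_apply _ _ _
  have h2 : ∀ x, contractHom (P y) (extDeriv b y) ![x] =
      (1 / 2 : ℝ) * coeffSum (P y) fun i j => extDeriv b y ![e j, e i, x] := fun x =>
    contractHom_apply _ _ _
  have h3 : pairing (P y) (b y) = coeffSum (P y) fun i j => b y ![e j, e i] := rfl
  rw [wedgeHom_one_two, hθ, hθ, hθ, h1, h2, h2, h2, schoutenModel_self_apply]
  simp only [extDeriv, alternatizeUncurryFin_apply_three, alternatizeUncurryFin_apply_five,
    fderiv_pairing_smul_add_twist hP hb, fderiv_wedgeHom_self hb, gaugeDeriv, map_add,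
    ContinuousAlternatingMap.add_apply, twist_apply, h3, clm_bivSharp_apply]
  generalize fderiv ℝ (fun z => pairing (P z) (b z)) y = T
  generalize fderiv ℝ P y = DP
  have key := coeffSum_identity (P y) (b y) (fun a => fderiv ℝ b y a) u v w
  clear h1 h2 h3 hθ
  generalize fderiv ℝ b y = D at *
  generalize b y = B at *
  generalize P y = Z at *
  have hl : coeffSum Z (fun i j => B ![u, e i] * D (e j) ![v, w] -
      B ![v, e i] * D (e j) ![u, w] + B ![w, e i] * D (e j) ![u, v]) =
      coeffSum Z (fun i j => B ![u, e i] * D (e j) ![v, w]) -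
      coeffSum Z (fun i j => B ![v, e i] * D (e j) ![u, w]) +
      coeffSum Z (fun i j => B ![w, e i] * D (e j) ![u, v]) := by
    rw [← map_sub, ← map_add]
    rfl
  have hr : coeffSum Z (fun i j => B ![u, e i] * D (e j) ![v, w]) -
      coeffSum Z (fun i j => B ![v, e i] * D (e j) ![u, w]) +
      coeffSum Z (fun i j => B ![w, e i] * D (e j) ![u, v]) = (-(1 / 4 : ℝ)) * coeffSum Z (fun i j =>
        2 * wedgeHom rfl (D (e j)) B ![e i, u, v, w] -
        2 * wedgeHom rfl (D (e i)) B ![e j, u, v, w] +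
        2 * wedgeHom rfl (D u) B ![e j, e i, v, w] -
        2 * wedgeHom rfl (D v) B ![e j, e i, u, w] +
        2 * wedgeHom rfl (D w) B ![e j, e i, u, v]) +
      (1 / 2 * (D u ![v, w] - D v ![u, w] + D w ![u, v])) * coeffSum Z (fun i j => B ![e j, e i]) +
      ((coeffSum Z (fun i j => D u ![v, e i] * B ![w, e j]) +
          coeffSum Z (fun i j => B ![v, e i] * D u ![w, e j])) -
        (coeffSum Z (fun i j => D v ![u, e i] * B ![w, e j]) +
          coeffSum Z (fun i j => B ![u, e i] * D v ![w, e j])) +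
        (coeffSum Z (fun i j => D w ![u, e i] * B ![v, e j]) +
          coeffSum Z (fun i j => B ![u, e i] * D w ![v, e j]))) +
      ((1 / 2 * B ![v, w]) *
          coeffSum Z (fun i j => D (e j) ![e i, u] - D (e i) ![e j, u] + D u ![e j, e i]) -
        (1 / 2 * B ![u, w]) *
          coeffSum Z (fun i j => D (e j) ![e i, v] - D (e i) ![e j, v] + D v ![e j, e i]) +
        (1 / 2 * B ![u, v]) *
          coeffSum Z (fun i j => D (e j) ![e i, w] - D (e i) ![e j, w] + D w ![e j, e i])) := by
    rw [← hl, ← key]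
    simp only [← smul_eq_mul (_ : ℝ) (coeffSum Z _), ← map_smul, ← map_sub, ← map_add]
    refine congrArg (coeffSum Z) ?_
    funext i j
    simp only [Pi.add_apply, Pi.sub_apply, Pi.smul_apply, smul_eq_mul]
    ring
  linear_combination -hr

end Model

/-! ### The ternary bracket of a two-form -/

theorem trivector_eq_sum (T : MV n 3) (ξ η ζ : Cov n) :
    T ![ξ, η, ζ] = ∑ i, ∑ j, ∑ k, T ![dx i, dx j, dx k] * (ξ (e i) * η (e j) * ζ (e k)) := by
  have h : T ![ξ, η, ζ] = ∑ i, ξ (e i) * T ![dx i, η, ζ] := by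
    change T.curryLeft ξ ![η, ζ] = ∑ i, ξ (e i) * T.curryLeft (dx i) ![η, ζ]
    conv_lhs => rw [eq_sum_dx ξ]
    simp only [map_sum, map_smul, ContinuousAlternatingMap.sum_apply,
      ContinuousAlternatingMap.smul_apply, smul_eq_mul]
  rw [h]
  refine Finset.sum_congr rfl fun i _ => ?_
  change _ * T.curryLeft (dx i) ![η, ζ] = _
  rw [biv_eq_sum, Finset.mul_sum]
  refine Finset.sum_congr rfl fun j _ => ?_
  rw [Finset.mul_sum]
  refine Finset.sum_congr rfl fun k _ => ?_
  change _ * (T ![dx i, dx j, dx k] * _) = _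
  ring

theorem alt_three_swap_right {V : Type*} [NormedAddCommGroup V] [NormedSpace ℝ V]
    (T : V [⋀^Fin 3]→L[ℝ] ℝ) (u v w : V) : T ![u, v, w] = -T ![u, w, v] :=
  alt_swap (T.curryLeft u) v w

theorem alt_three_swap_left {V : Type*} [NormedAddCommGroup V] [NormedSpace ℝ V]
    (T : V [⋀^Fin 3]→L[ℝ] ℝ) (u v w : V) : T ![u, v, w] = -T ![v, u, w] := by
  have h := T.toAlternatingMap.map_swap ![v, u, w] (i := 0) (j := 1) (by decide)
  rw [← ContinuousAlternatingMap.coe_toAlternatingMap, ← h]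
  congr 1
  ext i
  fin_cases i <;> rfl

theorem interiorProd_single (v : E n) (β : Alt n 2) :
    interiorProd v (Pi.single 2 β) = Pi.single 1 (β.curryLeft v) := by
  funext k
  by_cases h : k = 1
  · subst h
    simp [interiorProd]
  · rw [Pi.single_eq_of_ne h, interiorProd, Pi.single_eq_of_ne (by omega)]
    rfl

/-- The wedge of the three one-forms `ι_a β`, `ι_b β`, `ι_c β`. -/
noncomputable def wedgeThree (β : Alt n 2) (a b c : E n) : Alt n 3 :=
  wedgeHom (p := 2) (q := 1) rfl
    (wedgeHom (p := 1) (q := 1) rfl (β.curryLeft a) (β.curryLeft b)) (β.curryLeft c)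

theorem wedgeThree_apply (β : Alt n 2) (a b c u v w : E n) :
    wedgeThree β a b c ![u, v, w] =
      β ![c, u] * (β ![a, v] * β ![b, w] - β ![a, w] * β ![b, v]) -
      β ![c, v] * (β ![a, u] * β ![b, w] - β ![a, w] * β ![b, u]) +
      β ![c, w] * (β ![a, u] * β ![b, v] - β ![a, v] * β ![b, u]) := by
  rw [wedgeThree, wedgeHom_two_one, wedgeHom_one_one, wedgeHom_one_one, wedgeHom_one_one]
  rfl

/-- For equal arguments the six summands of `sharpWedge` coincide. -/
theorem sharpWedge_single (β : Alt n 2) (v : Fin 3 → E n) :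
    sharpWedge (Pi.single 2 β) (Pi.single 2 β) (Pi.single 2 β) v =
      Pi.single 3 ((6 : ℝ) • wedgeThree β (v 0) (v 1) (v 2)) := by
  have h : ∀ a b c, wedge (wedge (interiorProd a (Pi.single 2 β)) (interiorProd b (Pi.single 2 β)))
      (interiorProd c (Pi.single 2 β)) = Pi.single 3 (wedgeThree β a b c) := fun a b c => by
    rw [interiorProd_single, interiorProd_single, interiorProd_single, wedge_single, wedge_single]
    rfl
  rw [sharpWedge]
  simp_rw [h]
  rw [sum_perm_fin_three fun i j k => (Pi.single 3 (wedgeThree β (v i) (v j) (v k)) : Ext n)]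
  simp only [← Pi.single_sub, ← Pi.single_add]
  congr 1
  refine alt_ext_three fun x y z => ?_
  simp only [ContinuousAlternatingMap.sub_apply, ContinuousAlternatingMap.add_apply,
    ContinuousAlternatingMap.smul_apply, wedgeThree_apply, smul_eq_mul]
  ring

/-- The factor `-6` is `3!` from the sum over `S₃`, with the sign `(-1)³` that comes from
`β(eᵢ, ·) = -β(·, eᵢ)` in each of the three slots. -/
theorem sharpWedgeTri_single (β : Alt n 2) (T : MV n 3) :
    sharpWedgeTri (Pi.single 2 β) (Pi.single 2 β) (Pi.single 2 β) T =
      Pi.single 3 ((-6 : ℝ) • T.compContinuousLinearMap (formSharp β)) := by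
  rw [sharpWedgeTri]
  simp_rw [sharpWedge_single, ← Pi.single_smul]
  have hs : ∀ f : Fin n → Alt n 3, ∑ i, (Pi.single 3 (f i) : Ext n) = Pi.single 3 (∑ i, f i) :=
    fun f => (map_sum (AddMonoidHom.single (Alt n) 3) f Finset.univ).symm
  simp_rw [hs]
  rw [← Pi.single_smul]
  congr 1
  refine alt_ext_three fun u v w => ?_
  have hc : T.compContinuousLinearMap (formSharp β) ![u, v, w] =
      T ![formSharp β u, formSharp β v, formSharp β w] := by
    change T _ = T _
    congr 1
    ext i : 1; fin_cases i <;> rfl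
  simp only [ContinuousAlternatingMap.smul_apply, ContinuousAlternatingMap.sum_apply, hc,
    smul_eq_mul, wedgeThree_apply, Matrix.cons_val]
  have hT : ∀ a b c : E n, T ![formSharp β a, formSharp β b, formSharp β c] =
      -∑ i, ∑ j, ∑ k, T ![dx i, dx j, dx k] * (β ![e i, a] * β ![e j, b] * β ![e k, c]) :=
    fun a b c => by
      rw [trivector_eq_sum]
      simp_rw [← Finset.sum_neg_distrib, formSharp_apply, alt_swap β a, alt_swap β b, alt_swap β c]
      refine Finset.sum_congr rfl fun i _ => Finset.sum_congr rfl fun j _ =>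
        Finset.sum_congr rfl fun k _ => ?_
      ring
  have h1 := hT u v w
  have h2 := hT u w v
  have h3 := hT v u w
  have h4 := hT v w u
  have h5 := hT w u v
  have h6 := hT w v u
  rw [alt_three_swap_right] at h2
  rw [alt_three_swap_left] at h3
  rw [alt_three_swap_right, alt_three_swap_left] at h4
  rw [alt_three_swap_left, alt_three_swap_right] at h5
  rw [alt_three_swap_left, alt_three_swap_right, alt_three_swap_left] at h6
  have hsum : ∑ i, ∑ j, ∑ k, T ![dx i, dx j, dx k] * (6 *
      (β ![e k, u] * (β ![e i, v] * β ![e j, w] - β ![e i, w] * β ![e j, v]) -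
      β ![e k, v] * (β ![e i, u] * β ![e j, w] - β ![e i, w] * β ![e j, u]) +
      β ![e k, w] * (β ![e i, u] * β ![e j, v] - β ![e i, v] * β ![e j, u]))) =
      6 * (∑ i, ∑ j, ∑ k, T ![dx i, dx j, dx k] * (β ![e i, v] * β ![e j, w] * β ![e k, u]) -
        ∑ i, ∑ j, ∑ k, T ![dx i, dx j, dx k] * (β ![e i, w] * β ![e j, v] * β ![e k, u]) -
        ∑ i, ∑ j, ∑ k, T ![dx i, dx j, dx k] * (β ![e i, u] * β ![e j, w] * β ![e k, v]) +
        ∑ i, ∑ j, ∑ k, T ![dx i, dx j, dx k] * (β ![e i, w] * β ![e j, u] * β ![e k, v]) +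
        ∑ i, ∑ j, ∑ k, T ![dx i, dx j, dx k] * (β ![e i, u] * β ![e j, v] * β ![e k, w]) -
        ∑ i, ∑ j, ∑ k, T ![dx i, dx j, dx k] * (β ![e i, v] * β ![e j, u] * β ![e k, w])) := by
    simp only [← Finset.sum_sub_distrib, ← Finset.sum_add_distrib, Finset.mul_sum]
    refine Finset.sum_congr rfl fun i _ => Finset.sum_congr rfl fun j _ =>
      Finset.sum_congr rfl fun k _ => ?_
    ring
  rw [hsum]
  linarith

/-! ### Homogeneous elements of `Ω(M)` -/

section Homogeneous

variable {M : Type*}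

theorem iota_ofDegree {k : ℕ} (Z : M → MV n 2) (τ : M → Alt n (k + 2)) :
    iota Z (ofDegree (k + 2) τ) = ofDegree k fun x => contractHom (Z x) (τ x) :=
  funext fun x => contract_single (Z x) (τ x)

theorem wedgeF_ofDegree {p q : ℕ} (α : M → Alt n p) (β : M → Alt n q) :
    wedgeF (ofDegree p α) (ofDegree q β) =
      ofDegree (p + q) fun x => wedgeHom rfl (α x) (β x) :=
  funext fun x => wedge_single (α x) (β x)

theorem gradeInvF_ofDegree_two (β : M → Alt n 2) :
    gradeInvF (ofDegree 2 β) = ofDegree 2 β := by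
  funext x k
  change (-1 : ℝ) ^ k • (Pi.single 2 (β x) : Ext n) k = (Pi.single 2 (β x) : Ext n) k
  by_cases h : k = 2
  · subst h
    simp
  · rw [Pi.single_eq_of_ne h, smul_zero]

theorem ofDegree_sub {k : ℕ} (σ τ : M → Alt n k) :
    ofDegree k σ - ofDegree k τ = ofDegree k (σ - τ) :=
  funext fun _ => (Pi.single_sub _ _ _).symm

theorem ofDegree_add {k : ℕ} (σ τ : M → Alt n k) :
    ofDegree k σ + ofDegree k τ = ofDegree k (σ + τ) :=
  funext fun _ => (Pi.single_add _ _ _).symm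

theorem ofDegree_neg {k : ℕ} (τ : M → Alt n k) : -ofDegree k τ = ofDegree k (-τ) :=
  funext fun _ => (Pi.single_neg _ _).symm

theorem ofDegree_smul {k : ℕ} (c : ℝ) (τ : M → Alt n k) :
    c • ofDegree k τ = ofDegree k (c • τ) :=
  funext fun x => (Pi.single_smul k c (τ x)).symm

theorem ofDegree_eq_zero_iff {k : ℕ} (τ : M → Alt n k) : ofDegree k τ = 0 ↔ ∀ x, τ x = 0 := by
  refine ⟨fun h x => ?_, fun h => ?_⟩
  · have := congrFun (congrFun h x) k
    rwa [ofDegree, Pi.single_eq_same] at this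
  · funext x
    rw [ofDegree, h x, Pi.single_zero]
    rfl

end Homogeneous

/-! ### Charts -/

section Manifold

variable {M : Type*} [TopologicalSpace M] [ChartedSpace (E n) M]

theorem SmoothForm.differentiableAt {k : ℕ} {τ : M → Alt n k} (hτ : SmoothForm τ) (x : M) :
    DifferentiableAt ℝ (formInChart τ x) (extChartAt (𝓡 n) x x) :=
  ((hτ x).contDiffAt (extChartAt_target_mem_nhds x)).differentiableAt (by simp)

theorem SmoothMV.differentiableAt {k : ℕ} {Z : M → MV n k} (hZ : SmoothMV Z) (x : M) :
    DifferentiableAt ℝ (mvInChart Z x) (extChartAt (𝓡 n) x x) :=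
  ((hZ x).contDiffAt (extChartAt_target_mem_nhds x)).differentiableAt (by simp)

section Smooth

variable [IsManifold (𝓡 n) ∞ M]

theorem dChart_comp_dChartSymm (x : M) {y : E n} (hy : y ∈ (extChartAt (𝓡 n) x).target) :
    dChart x ((extChartAt (𝓡 n) x).symm y) ∘L dChartSymm x y =
      ContinuousLinearMap.id ℝ (E n) := by
  have : IsManifold (𝓡 n) 1 M := IsManifold.of_le (n := ∞) (by simp)
  have h := mfderiv_extChartAt_comp_mfderivWithin_extChartAt_symm (I := 𝓡 n) hy
  rw [ModelWithCorners.range_eq_univ, mfderivWithin_univ] at h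
  exact h

theorem dChartSymm_comp_dChart (x : M) {y : E n} (hy : y ∈ (extChartAt (𝓡 n) x).target) :
    dChartSymm x y ∘L dChart x ((extChartAt (𝓡 n) x).symm y) =
      ContinuousLinearMap.id ℝ (E n) := by
  have : IsManifold (𝓡 n) 1 M := IsManifold.of_le (n := ∞) (by simp)
  have h := mfderivWithin_extChartAt_symm_comp_mfderiv_extChartAt (I := 𝓡 n) hy
  rw [ModelWithCorners.range_eq_univ, mfderivWithin_univ] at h
  exact h

/-- The tangent space at `x` is identified with `ℝⁿ` by means of the chart at `x`. -/
theorem dChart_self (x : M) : dChart x x = ContinuousLinearMap.id ℝ (E n) := by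
  have : IsManifold (𝓡 n) 1 M := IsManifold.of_le (n := ∞) (by simp)
  have hx := mem_chart_source (E n) x
  have h : dChart x x = mfderiv (𝓡 n) (𝓡 n) (chartAt (E n) x) x :=
    (hasMFDerivAt_extChartAt hx).mfderiv
  rw [h, mfderiv_chartAt_eq_tangentCoordChange hx]
  ext1 v
  exact tangentCoordChange_self (mem_extChartAt_source x)

theorem dChartSymm_self (x : M) :
    dChartSymm x (extChartAt (𝓡 n) x x) = ContinuousLinearMap.id ℝ (E n) := by
  have h := dChart_comp_dChartSymm x (mem_extChartAt_target (I := 𝓡 n) x)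
  rw [extChartAt_to_inv, dChart_self] at h
  exact h

theorem formInChart_self {k : ℕ} (τ : M → Alt n k) (x : M) :
    formInChart τ x (extChartAt (𝓡 n) x x) = τ x := by
  rw [formInChart, dChartSymm_self, extChartAt_to_inv]
  rfl

theorem mvInChart_self {k : ℕ} (Z : M → MV n k) (x : M) :
    mvInChart Z x (extChartAt (𝓡 n) x x) = Z x := by
  rw [mvInChart, extChartAt_to_inv, dChart_self]
  rfl

/-- Since the derivative at `x` of the chart at `x` is the identity, the exterior derivative at `x`
is that of the coordinate expression. -/
theorem extD_eq {k : ℕ} (τ : M → Alt n k) (x : M) :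
    extD τ x = extDeriv (formInChart τ x) (extChartAt (𝓡 n) x x) := by
  rw [extD, dChart_self]
  rfl

theorem schouten_eq (P Q : M → MV n 2) (x : M) :
    schouten P Q x =
      schoutenModel (mvInChart P x) (mvInChart Q x) (extChartAt (𝓡 n) x x) := by
  rw [schouten, dChartSymm_self]
  rfl

theorem extD_congr {k : ℕ} {τ : M → Alt n k} {x : M} {f : E n → Alt n k}
    (h : ∀ y ∈ (extChartAt (𝓡 n) x).target, formInChart τ x y = f y) :
    extD τ x = extDeriv f (extChartAt (𝓡 n) x x) := by
  rw [extD_eq]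
  refine Filter.EventuallyEq.extDeriv_eq ?_
  filter_upwards [extChartAt_target_mem_nhds (I := 𝓡 n) x] with y hy using h y hy

theorem mem_invSet_inChart {Z : M → MV n 2} {β : M → Alt n 2} (x : M) {y : E n}
    (hy : y ∈ (extChartAt (𝓡 n) x).target)
    (hβ : β ((extChartAt (𝓡 n) x).symm y) ∈ invSet (Z ((extChartAt (𝓡 n) x).symm y))) :
    formInChart β x y ∈ invSet (mvInChart Z x y) :=
  (mem_invSet_pullback (dChartSymm_comp_dChart x hy) (dChart_comp_dChartSymm x hy) _ _).2 hβ

theorem formInChart_FForm {Z : M → MV n 2} {β : M → Alt n 2} (hβ : ∀ x, β x ∈ invSet (Z x))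
    (x : M) {y : E n} (hy : y ∈ (extChartAt (𝓡 n) x).target) :
    formInChart (FForm Z β hβ) x y =
      F (mvInChart Z x y) (formInChart β x y) (mem_invSet_inChart x hy (hβ _)) :=
  F_pullback (dChartSymm_comp_dChart x hy) _ _ _ _

theorem formInChart_contract_wedge_self (Z : M → MV n 2) (β : M → Alt n 2) (x : M) {y : E n}
    (hy : y ∈ (extChartAt (𝓡 n) x).target) :
    formInChart (fun z => contractHom (Z z) (wedgeHom (p := 2) (q := 2) rfl (β z) (β z))) x y =
      pairing (mvInChart Z x y) (formInChart β x y) • formInChart β x y +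
        (2 : ℝ) • twist (mvInChart Z x y) (formInChart β x y) := by
  have h := dChartSymm_comp_dChart x hy
  simp only [formInChart, mvInChart]
  rw [pairing_pullback h, twist_pullback h, contractHom_wedge_self]
  rfl

theorem formInChart_contract (Z : M → MV n 2) (β : M → Alt n 2) (x : M) {y : E n}
    (hy : y ∈ (extChartAt (𝓡 n) x).target) (w : Fin 0 → E n) :
    formInChart (fun z => contractHom (k := 0) (Z z) (β z)) x y w =
      (1 / 2 : ℝ) * pairing (mvInChart Z x y) (formInChart β x y) := by
  have h := dChartSymm_comp_dChart x hy
  simp only [formInChart, mvInChart]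
  rw [pairing_pullback h]
  exact contractHom_two_apply _ _ _

end Smooth

theorem wedgeHom_comp {p q m : ℕ} (h : p + q = m) (α : Alt n p) (β : Alt n q)
    (K : E n →L[ℝ] E n) :
    (wedgeHom h α β).compContinuousLinearMap K =
      wedgeHom h (α.compContinuousLinearMap K) (β.compContinuousLinearMap K) := by
  ext v
  rw [ContinuousAlternatingMap.compContinuousLinearMap_apply, wedgeHom_apply, wedgeHom_apply]
  rfl

theorem formInChart_zero {k : ℕ} (x : M) : formInChart (fun _ => (0 : Alt n k)) x = 0 := rfl

theorem extD_zero {k : ℕ} (x : M) : extD (fun _ => (0 : Alt n k)) x = 0 := by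
  rw [extD, formInChart_zero]
  have : extDeriv (0 : E n → Alt n k) (extChartAt (𝓡 n) x x) = 0 := by
    ext v
    simp [extDeriv, ContinuousAlternatingMap.alternatizeUncurryFin_apply]
  rw [this]
  rfl

/-! ### The brackets of a two-form -/

theorem deRham_ofDegree {k : ℕ} (τ : M → Alt n k) :
    deRham (ofDegree k τ) = ofDegree (k + 1) (extD τ) := by
  funext x m
  cases m with
  | zero => exact (Pi.single_eq_of_ne (by omega) _).symm
  | succ j =>
    change extD (fun y => (Pi.single k (τ y) : Ext n) j) x = (Pi.single (k + 1) (extD τ x) : Ext n) _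
    by_cases h : j = k
    · subst h
      simp
    · rw [Pi.single_eq_of_ne (by omega)]
      simp_rw [Pi.single_eq_of_ne h]
      exact extD_zero x

/-- `𝓛_Z = ι_Z ∘ d - d ∘ ι_Z` on forms of degree `k + 2`. The degrees `0` and `1`, on which `ι_Z`
vanishes, are not covered. -/
noncomputable def lieHom {k : ℕ} (Z : M → MV n 2) (τ : M → Alt n (k + 2)) (x : M) :
    Alt n (k + 1) :=
  contractHom (Z x) (extD τ x) - extD (fun y => contractHom (Z y) (τ y)) x

theorem lieZ_ofDegree {k : ℕ} (Z : M → MV n 2) (τ : M → Alt n (k + 2)) :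
    lieZ Z (ofDegree (k + 2) τ) = ofDegree (k + 1) (lieHom Z τ) := by
  rw [lieZ, deRham_ofDegree, iota_ofDegree (k := k + 1), iota_ofDegree, deRham_ofDegree,
    ofDegree_sub]
  rfl

/-- The degree-three part of the Maurer–Cartan expression of a two-form; all its other parts
vanish. -/
noncomputable def maurerCartanForm (Z : M → MV n 2) (β : M → Alt n 2) (x : M) : Alt n 3 :=
  extD β x - (1 / 2 : ℝ) •
    (lieHom (k := 2) Z (fun y => wedgeHom (p := 2) (q := 2) rfl (β y) (β y)) x -
      wedgeHom (p := 1) (q := 2) rfl (lieHom (k := 0) Z β x) (β x) -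
      wedgeHom (p := 2) (q := 1) rfl (β x) (lieHom (k := 0) Z β x)) +
    (1 / 2 : ℝ) • (schouten Z Z x).compContinuousLinearMap (formSharp (β x))

theorem isMaurerCartan_iff (Z : M → MV n 2) (β : M → Alt n 2) :
    IsMaurerCartan Z β ↔ ∀ x, maurerCartanForm Z β x = 0 := by
  have h1 : lambda1 (ofDegree 2 β) = ofDegree 3 (extD β) := deRham_ofDegree β
  have h2 : lambda2 Z (ofDegree 2 β) (ofDegree 2 β) = -(
      ofDegree 3 (lieHom (k := 2) Z (fun y => wedgeHom (p := 2) (q := 2) rfl (β y) (β y))) -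
      ofDegree 3 (fun x => wedgeHom (p := 1) (q := 2) rfl (lieHom (k := 0) Z β x) (β x)) -
      ofDegree 3 (fun x => wedgeHom (p := 2) (q := 1) rfl (β x) (lieHom (k := 0) Z β x))) := by
    rw [lambda2, koszulBracket, gradeInvF_ofDegree_two, gradeInvF_ofDegree_two, wedgeF_ofDegree,
      lieZ_ofDegree (k := 0), lieZ_ofDegree (k := 2), wedgeF_ofDegree, wedgeF_ofDegree]
  have h3 : lambda3 Z (ofDegree 2 β) (ofDegree 2 β) (ofDegree 2 β) =
      ofDegree 3 fun x => (3 : ℝ) • (schouten Z Z x).compContinuousLinearMap (formSharp (β x)) := by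
    rw [lambda3, gradeInvF_ofDegree_two]
    funext x
    change -sharpWedgeTri (Pi.single 2 (β x)) (Pi.single 2 (β x)) (Pi.single 2 (β x)) _ = _
    rw [sharpWedgeTri_single, ← Pi.single_neg]
    refine congrArg (Pi.single 3) ?_
    ext v
    simp
    ring
  rw [IsMaurerCartan, h1, h2, h3, ofDegree_sub, ofDegree_sub, ofDegree_neg, ofDegree_smul,
    ofDegree_smul, ofDegree_add, ofDegree_add, ofDegree_eq_zero_iff]
  refine forall_congr' fun x => ?_
  refine Eq.congr_left ?_
  ext v
  simp [maurerCartanForm]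
  ring

end Manifold

section Global

variable {M : Type*} [TopologicalSpace M] [ChartedSpace (E n) M]

/-! ### Openness of `𝓘_Z` and smoothness of `F(β)` -/

theorem zero_mem_invSet (Z : MV n 2) : (0 : Alt n 2) ∈ invSet Z := by
  have h : formSharp (0 : Alt n 2) = 0 := by
    ext v w
    simp [formSharp_apply]
  change IsUnit _
  rw [h, ContinuousLinearMap.comp_zero, add_zero]
  exact isUnit_one

theorem contDiffOn_formSharp {b : E n → Alt n 2} {s : Set (E n)} (hb : ContDiffOn ℝ ∞ b s) :
    ContDiffOn ℝ ∞ (fun z => formSharpL n (b z)) s :=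
  ContDiff.comp_contDiffOn (𝕜 := ℝ) (E := E n) (F := Alt n 2) (G := E n →L[ℝ] Cov n)
    (ContinuousLinearMap.contDiff (𝕜 := ℝ) (E := Alt n 2) (F := E n →L[ℝ] Cov n)
      (formSharpL n)) hb

theorem contDiffOn_bivSharp {P : E n → MV n 2} {s : Set (E n)} (hP : ContDiffOn ℝ ∞ P s) :
    ContDiffOn ℝ ∞ (fun z => bivSharpL n (P z)) s :=
  ContDiff.comp_contDiffOn (𝕜 := ℝ) (E := E n) (F := MV n 2) (G := Cov n →L[ℝ] E n)
    (ContinuousLinearMap.contDiff (𝕜 := ℝ) (E := MV n 2) (F := Cov n →L[ℝ] E n)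
      (bivSharpL n)) hP

theorem isOpenInTwoForms_invSet [IsManifold (𝓡 n) ∞ M] {Z : M → MV n 2} (hZ : SmoothMV Z) :
    IsOpenInTwoForms fun x => invSet (Z x) := by
  intro x
  -- In the chart, `β ∈ 𝓘_Z` becomes the same condition for the coordinate expressions.
  have hS : {p : E n × Alt n 2 | p.1 ∈ (extChartAt (𝓡 n) x).target ∧
      p.2.compContinuousLinearMap (dChart x ((extChartAt (𝓡 n) x).symm p.1)) ∈
        invSet (Z ((extChartAt (𝓡 n) x).symm p.1))} =
      ((extChartAt (𝓡 n) x).target ×ˢ Set.univ) ∩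
        (fun p : E n × Alt n 2 =>
          (1 + bivSharpL n (mvInChart Z x p.1) ∘L formSharpL n p.2 : E n →L[ℝ] E n)) ⁻¹'
            {A | IsUnit A} := by
    ext p
    simp only [Set.mem_ofPred_eq, Set.mem_inter_iff, Set.mem_prod, Set.mem_univ, and_true,
      Set.mem_preimage]
    refine and_congr_right fun hp => ?_
    have h := mem_invSet_pullback (dChartSymm_comp_dChart x hp) (dChart_comp_dChartSymm x hp)
      (Z ((extChartAt (𝓡 n) x).symm p.1))
      (p.2.compContinuousLinearMap (dChart x ((extChartAt (𝓡 n) x).symm p.1)))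
    have h' : (p.2.compContinuousLinearMap
        (dChart x ((extChartAt (𝓡 n) x).symm p.1))).compContinuousLinearMap
          (dChartSymm x p.1) = p.2 := by
      refine alt_ext_two fun v w => ?_
      have hv : ∀ v, dChart x ((extChartAt (𝓡 n) x).symm p.1) (dChartSymm x p.1 v) = v :=
        DFunLike.congr_fun (dChart_comp_dChartSymm x hp)
      rw [compContinuousLinearMap_two, compContinuousLinearMap_two, hv, hv]
    rw [h'] at h
    exact h.symm
  rw [hS]
  refine ContinuousOn.isOpen_inter_preimage ?_
    ((isOpen_extChartAt_target x).prod isOpen_univ) Units.isOpen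
  have h1 : ContinuousOn (fun p : E n × Alt n 2 => bivSharpL n (mvInChart Z x p.1))
      ((extChartAt (𝓡 n) x).target ×ˢ Set.univ) :=
    (contDiffOn_bivSharp (hZ x)).continuousOn.comp continuousOn_fst fun p hp => hp.1
  have h2 : Continuous fun p : E n × Alt n 2 => formSharpL n p.2 :=
    (formSharpL n).continuous.comp continuous_snd
  exact continuousOn_const.add (h1.clm_comp h2.continuousOn)

theorem smoothForm_FForm [IsManifold (𝓡 n) ∞ M] {Z : M → MV n 2} (hZ : SmoothMV Z)
    {β : M → Alt n 2} (hs : SmoothForm β) (hβ : ∀ x, β x ∈ invSet (Z x)) :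
    SmoothForm (FForm Z β hβ) := by
  intro x
  refine contDiffOn_alt fun u => ?_
  have hA : ContDiffOn ℝ ∞ (fun z => (1 + bivSharpL n (mvInChart Z x z) ∘L
      formSharpL n (formInChart β x z) : E n →L[ℝ] E n)) (extChartAt (𝓡 n) x).target :=
    contDiffOn_const.add ((contDiffOn_bivSharp (hZ x)).clm_comp (contDiffOn_formSharp (hs x)))
  have hI : ContDiffOn ℝ ∞ (fun z => Ring.inverse (1 + bivSharpL n (mvInChart Z x z) ∘L
      formSharpL n (formInChart β x z) : E n →L[ℝ] E n)) (extChartAt (𝓡 n) x).target := by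
    intro z hz
    obtain ⟨U, hU⟩ := mem_invSet_inChart (Z := Z) x hz (hβ _)
    have h := contDiffAt_ringInverse ℝ (n := ∞) U
    rw [hU] at h
    exact h.comp_contDiffWithinAt z (hA z hz)
  have h := ((contDiffOn_formSharp (hs x)).clm_apply (hI.clm_apply
    (contDiffOn_const (c := u 0)))).clm_apply (contDiffOn_const (c := u 1))
  refine h.congr fun z hz => ?_
  rw [formInChart_FForm hβ x hz]
  rfl

/-! ### The Maurer–Cartan equation and closedness of `F(β)` -/

/-- The Maurer–Cartan expression is the pullback of `dF(β)` under `id + Z♯ β♯`. -/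
theorem maurerCartanForm_apply [IsManifold (𝓡 n) ∞ M] {Z : M → MV n 2} (hZ : SmoothMV Z)
    {β : M → Alt n 2} (hs : SmoothForm β) (hβ : ∀ x, β x ∈ invSet (Z x)) (x : M) (u v w : E n) :
    maurerCartanForm Z β x ![u, v, w] =
      extD (FForm Z β hβ) x ![u + bivSharp (Z x) (formSharp (β x) u),
        v + bivSharp (Z x) (formSharp (β x) v), w + bivSharp (Z x) (formSharp (β x) w)] := by
  have hP := hZ.differentiableAt x
  have hb := hs.differentiableAt x
  have hG := (smoothForm_FForm hZ hs hβ).differentiableAt x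
  have key : ∀ᶠ z in nhds (extChartAt (𝓡 n) x x), ∀ v w,
      formInChart (FForm Z β hβ) x z ![v + bivSharp (mvInChart Z x z)
        (formSharp (formInChart β x z) v), w] = formInChart β x z ![v, w] := by
    filter_upwards [extChartAt_target_mem_nhds (I := 𝓡 n) x] with z hz v w
    rw [formInChart_FForm hβ x hz, F_apply]
  have h1 := extDeriv_apply_add_sharp hP hb hG key u v w
  have h2 := @maurerCartan_model n _ _ _ hP hb (lieHom (k := 0) Z β x)
  rw [← extD_eq, ← extD_congr (f := fun z => wedgeHom (p := 2) (q := 2) rfl (formInChart β x z)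
      (formInChart β x z)) (τ := fun z => wedgeHom (p := 2) (q := 2) rfl (β z) (β z))
      fun z _ => wedgeHom_comp _ _ _ _,
    ← extD_congr (fun z hz => formInChart_contract_wedge_self Z β x hz), ← schouten_eq] at h2
  rw [← extD_eq] at h1
  simp only [formInChart_self, mvInChart_self] at h1 h2
  rw [h1, ← h2]
  · have hs3 : (schouten Z Z x).compContinuousLinearMap (formSharp (β x)) ![u, v, w] =
        schouten Z Z x ![formSharp (β x) u, formSharp (β x) v, formSharp (β x) w] := by
      change schouten Z Z x _ = schouten Z Z x _
      congr 1
      ext i : 1; fin_cases i <;> rfl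
    simp only [maurerCartanForm, ContinuousAlternatingMap.add_apply,
      ContinuousAlternatingMap.sub_apply, ContinuousAlternatingMap.smul_apply, hs3,
      wedgeHom_two_one, wedgeHom_one_two, smul_eq_mul]
    have hl : lieHom (k := 2) Z (fun y => wedgeHom (p := 2) (q := 2) rfl (β y) (β y)) x
        ![u, v, w] = contractHom (Z x)
          (extD (fun y => wedgeHom (p := 2) (q := 2) rfl (β y) (β y)) x) ![u, v, w] -
        extD (fun y => contractHom (Z y) (wedgeHom (p := 2) (q := 2) rfl (β y) (β y))) x
          ![u, v, w] := rfl
    rw [hl]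
    ring
  · intro a
    obtain ⟨L, hL, -⟩ := hasFDerivAt_pairing hP hb
    have hd : DifferentiableAt ℝ (formInChart (fun y => contractHom (k := 0) (Z y) (β y)) x)
        (extChartAt (𝓡 n) x x) := by
      refine differentiableAt_alt fun w => ?_
      refine (hL.const_mul (1 / 2)).differentiableAt.congr_of_eventuallyEq ?_
      filter_upwards [extChartAt_target_mem_nhds (I := 𝓡 n) x] with z hz
      exact formInChart_contract Z β x hz w
    have he : extD (fun y => contractHom (k := 0) (Z y) (β y)) x ![a] = (1 / 2 : ℝ) *
        fderiv ℝ (fun z => pairing (mvInChart Z x z) (formInChart β x z))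
          (extChartAt (𝓡 n) x x) a := by
      rw [extD_eq, extDeriv, alternatizeUncurryFin_apply_one, fderiv_alt_apply hd, hL.fderiv]
      have : (fun z => formInChart (fun y => contractHom (k := 0) (Z y) (β y)) x z ![])
          =ᶠ[nhds (extChartAt (𝓡 n) x x)]
          fun z => (1 / 2 : ℝ) * pairing (mvInChart Z x z) (formInChart β x z) := by
        filter_upwards [extChartAt_target_mem_nhds (I := 𝓡 n) x] with z hz
        exact formInChart_contract Z β x hz _
      rw [this.fderiv_eq, (hL.const_mul (1 / 2)).fderiv]
      rfl
    rw [← he]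
    rfl

theorem isMaurerCartan_iff_isClosedForm [IsManifold (𝓡 n) ∞ M] {Z : M → MV n 2}
    (hZ : SmoothMV Z) {β : M → Alt n 2} (hs : SmoothForm β) (hβ : ∀ x, β x ∈ invSet (Z x)) :
    IsMaurerCartan Z β ↔ IsClosedForm (FForm Z β hβ) := by
  rw [isMaurerCartan_iff]
  refine forall_congr' fun x => ⟨fun h => ?_, fun h => ?_⟩
  · refine alt_ext_three fun a b c => ?_
    obtain ⟨u, rfl⟩ := exists_add_sharp_eq (hβ x) a
    obtain ⟨v, rfl⟩ := exists_add_sharp_eq (hβ x) b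
    obtain ⟨w, rfl⟩ := exists_add_sharp_eq (hβ x) c
    rw [← maurerCartanForm_apply hZ hs hβ, h]
    rfl
  · refine alt_ext_three fun u v w => ?_
    rw [maurerCartanForm_apply hZ hs hβ, h]
    rfl

end Global

end KoszulMC

theorem corollary2p9 {n : ℕ} {M : Type*} [TopologicalSpace M]
    [ChartedSpace (EuclideanSpace ℝ (Fin n)) M] [IsManifold (𝓡 n) ∞ M]
    (Z : M → KoszulMC.MV n 2) (hZ : KoszulMC.SmoothMV Z) :
    KoszulMC.IsOpenInTwoForms (fun x => KoszulMC.invSet (Z x)) ∧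
    (∀ x, (0 : KoszulMC.Alt n 2) ∈ KoszulMC.invSet (Z x)) ∧
    ∀ (β : M → KoszulMC.Alt n 2), KoszulMC.SmoothForm β →
      ∀ hβ : ∀ x, β x ∈ KoszulMC.invSet (Z x),
        KoszulMC.SmoothForm (KoszulMC.FForm Z β hβ) ∧
        (KoszulMC.IsMaurerCartan Z β ↔ KoszulMC.IsClosedForm (KoszulMC.FForm Z β hβ)) :=
  ⟨KoszulMC.isOpenInTwoForms_invSet hZ, fun x => KoszulMC.zero_mem_invSet (Z x),
    fun _ hs hβ => ⟨KoszulMC.smoothForm_FForm hZ hs hβ,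
      KoszulMC.isMaurerCartan_iff_isClosedForm hZ hs hβ⟩⟩
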